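/- Let $k\ge 0$ and let $\mathcal C$ be a colored $(k+1)$-configuration with $n$ points and $n$ lines. That is: $\mathcal C$ consists of finite sets $P$ (points) and $L$ (lines) and an incidence relation $R\subseteq P\times L$ such that two distinct points are on at most one common line, each point is on exactly $k+1$ lines and each line contains exactly $k+1$ points; the bipartite incidence graph $G(\mathcal C)$ on $P\sqcup L$ is connected; and the incidences (edges of $G(\mathcal C)$) are colored with the colors $1,\dots,k+1$ so that distinct edges sharing a vertex have distinct colors and $\phi_c\phi_b\phi_a\phi_c\phi_b\phi_a=\mathrm{id}$ for all distinct colors $a,b,c$, where $\phi_c(v)$ denotes the neighbor of $v$ in $G(\mathcal C)$ along the edge of color $c$. Let $A_k=\{x\in\mathbb Z^{k+1}:\sum_i x_i=0\}$, with $d(x,y)=\tfrac12\|x-y\|_1$ and standard basis vectors $e_i$ of $\mathbb Z^{k+1}$, and let $W_k$ be the simplicial complex with vertex set $A_k$ whose faces are the nonempty sets of points at pairwise distance $1$. For all $v_0\in A_k$ and $p_0\in P$ there is exactly one labeling $\ell:A_k\to P$ with $\ell(v_0)=p_0$ and $\ell(u-e_i+e_j)=\phi_j(\phi_i(\ell(u)))$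 for all $u\in A_k$ and all $i\ne j$. For every such labeling, $H=\{v\in A_k:\ell(v)=\ell(0)\}$ is a subgroup of $A_k$, and $X(\mathcal C)=W_k/H$, whose vertices are the classes in $A_k/H$ and whose faces are the images of the faces of $W_k$, is a simplicial quotient: the quotient map is injective on each face of $W_k$, and two faces of $W_k$ have the same image only if they are translates of each other by an element of $H$. The complex $X(\mathcal C)$ is connected and $k$-dimensional, the fundamental group of its geometric realization is isomorphic to $\mathbb Z^k$, and the following hold. 1. $X(\mathcal C)$ has exactly $n$ vertices; more precisely, $\ell$ induces a bijection from the vertices of $X(\mathcal C)$ to $P$. 2. $X(\mathcal C)$ contains a copy of $\mathcal C$ consisting of $n$ distinct facets (the lines of $\mathcal C$ are represented by facets, each having as its vertices exactly the points of that line, where points are identified with vertices via $\ell$), and a copy of the dual $(k+1)$-configuration $\mathcal C^*$ consisting of $n$ distinct facets (the lines of $\mathcal C$ are represented by distinct vertices and the points of $\mathcal C$ by facets, each having as its vertices exactly those representing the lines through that point). Every facet of $X(\mathcal C)$ belongs to one of these two copies, and every face is contained in a facet. If $k\ge 2$, the two copies have no facet in common, so that $X(\mathcal C)$ has exactly $2n$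 facets. 3. If a group $G$ acts on $\mathcal C$ by automorphisms (permutations of points, lines and colors that preserve incidence and are compatible with the coloring), then the induced action on the points, transported to the vertices of $X(\mathcal C)$ via $\ell$, is an action of $G$ on $X(\mathcal C)$ by simplicial automorphisms. 4. If $\mathcal C$ is also a projective plane (any two distinct points are on a unique common line, any two distinct lines have a unique common point, and there are four distinct points of which no line contains more than two), then $X(\mathcal C)$ is 2-neighborly: any two distinct vertices form an edge. -/

import Mathlib

/-! ### Configurations -/

/-- A `k`-configuration with finite point set `P` and finite line set `L`. -/
structure KConfiguration (k : ℕ) (P L : Type*) [Finite P] [Finite L] where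
  /-- The incidence relation. -/
  Inc : P → L → Prop
  /-- Two distinct points are on at most one common line. -/
  eq_or_eq : ∀ {p₁ p₂ : P} {l₁ l₂ : L}, Inc p₁ l₁ → Inc p₁ l₂ → Inc p₂ l₁ → Inc p₂ l₂ →
    p₁ = p₂ ∨ l₁ = l₂
  /-- Each point is incident with exactly `k` lines. -/
  ncard_lines : ∀ p : P, {l : L | Inc p l}.ncard = k
  /-- Each line is incident with exactly `k` points. -/
  ncard_points : ∀ l : L, {p : P | Inc p l}.ncard = k

namespace KConfiguration

variable {k : ℕ} {P L : Type*} [Finite P] [Finite L]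

/-- The bipartite incidence graph `G(C)` on the disjoint union of points and lines. -/
def graph (C : KConfiguration k P L) : SimpleGraph (P ⊕ L) where
  Adj
    | .inl p, .inr l => C.Inc p l
    | .inr l, .inl p => C.Inc p l
    | _, _ => False
  symm := ⟨by rintro (p | l) (p' | l') h <;> exact h⟩
  loopless := ⟨by rintro (p | l) h <;> exact h⟩

/-- The dual configuration: points and lines are exchanged. -/
def dual (C : KConfiguration k P L) : KConfiguration k L P where
  Inc l p := C.Inc p l
  eq_or_eq h₁ h₂ h₃ h₄ := (C.eq_or_eq h₁ h₃ h₂ h₄).symm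
  ncard_lines := C.ncard_points
  ncard_points := C.ncard_lines

/-- The configuration is a (finite) projective plane. -/
structure IsProjectivePlane (C : KConfiguration k P L) : Prop where
  existsUnique_line : ∀ p₁ p₂ : P, p₁ ≠ p₂ → ∃! l : L, C.Inc p₁ l ∧ C.Inc p₂ l
  existsUnique_point : ∀ l₁ l₂ : L, l₁ ≠ l₂ → ∃! p : P, C.Inc p l₁ ∧ C.Inc p l₂
  /-- There are four distinct points such that each line contains at most two of them. -/
  exists_four_points : ∃ p : Fin 4 → P, Function.Injective p ∧
    ∀ l : L, {i : Fin 4 | C.Inc (p i) l}.ncard ≤ 2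

/-- A `k`-edge coloring of `G(C)`, the edges being the incidences of `C`. -/
structure EdgeColoring (C : KConfiguration k P L) where
  /-- The color of an incidence. -/
  color : ∀ (p : P) (l : L), C.Inc p l → Fin k
  color_ne_of_point : ∀ (p : P) (l₁ l₂ : L) (h₁ : C.Inc p l₁) (h₂ : C.Inc p l₂),
    l₁ ≠ l₂ → color p l₁ h₁ ≠ color p l₂ h₂
  color_ne_of_line : ∀ (p₁ p₂ : P) (l : L) (h₁ : C.Inc p₁ l) (h₂ : C.Inc p₂ l),
    p₁ ≠ p₂ → color p₁ l h₁ ≠ color p₂ l h₂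

namespace EdgeColoring

variable {C : KConfiguration k P L} (χ : C.EdgeColoring)

/-- Through each point there is exactly one line of each color. -/
theorem existsUnique_line (c : Fin k) (p : P) : ∃! l : L, ∃ h : C.Inc p l, χ.color p l h = c := by
  have hinj : Function.Injective (fun l : {l : L | C.Inc p l} => χ.color p l.1 l.2) := by
    intro l₁ l₂ h
    by_contra hne
    exact χ.color_ne_of_point p l₁ l₂ l₁.2 l₂.2 (fun e => hne (Subtype.ext e)) h
  have hcard : Nat.card {l : L | C.Inc p l} = Nat.card (Fin k) := by
    rw [Nat.card_coe_set_eq, C.ncard_lines, Nat.card_fin]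
  have hbij := (Nat.bijective_iff_injective_and_card _).2 ⟨hinj, hcard⟩
  obtain ⟨l, hl⟩ := hbij.2 c
  refine ⟨l, ⟨l.2, hl⟩, ?_⟩
  rintro l' ⟨h', hl'⟩
  exact congrArg Subtype.val (hinj (a₁ := ⟨l', h'⟩) (a₂ := l) (hl'.trans hl.symm))

/-- The same coloring, seen on the dual configuration. -/
def dual : C.dual.EdgeColoring where
  color l p h := χ.color p l h
  color_ne_of_point l p₁ p₂ := χ.color_ne_of_line p₁ p₂ l
  color_ne_of_line l₁ l₂ p := χ.color_ne_of_point p l₁ l₂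

/-- On each line there is exactly one point of each color. -/
theorem existsUnique_point (c : Fin k) (l : L) : ∃! p : P, ∃ h : C.Inc p l, χ.color p l h = c :=
  χ.dual.existsUnique_line c l

/-- The map `φ_c`: the neighbor in `G(C)` along the unique edge of color `c`. -/
noncomputable def phi (c : Fin k) : P ⊕ L → P ⊕ L
  | .inl p => .inr (χ.existsUnique_line c p).choose
  | .inr l => .inl (χ.existsUnique_point c l).choose

/-- The 6-cycle property. -/
def SixCycle : Prop :=
  ∀ (v : P ⊕ L) (a b c : Fin k), a ≠ b → a ≠ c → b ≠ c →
    χ.phi c (χ.phi b (χ.phi a (χ.phi c (χ.phi b (χ.phi a v))))) = v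

end EdgeColoring

end KConfiguration

/-- A colored `k`-configuration: a connected `k`-configuration with a `k`-edge coloring
satisfying the 6-cycle property. -/
structure ColoredConfiguration (k : ℕ) (P L : Type*) [Finite P] [Finite L] extends
    KConfiguration k P L where
  connected : toKConfiguration.graph.Connected
  /-- The edge coloring. -/
  coloring : toKConfiguration.EdgeColoring
  sixCycle : coloring.SixCycle

/-- The automorphism group of a colored configuration: triples of permutations of the points, the
lines and the colors that preserve incidence and are compatible with the coloring. -/
def ColoredConfiguration.Aut {k : ℕ} {P L : Type*} [Finite P] [Finite L]
    (C : ColoredConfiguration k P L) :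
    Subgroup (Equiv.Perm P × Equiv.Perm L × Equiv.Perm (Fin k)) where
  carrier := {ψ | ∃ hψ : ∀ p l, C.Inc p l ↔ C.Inc (ψ.1 p) (ψ.2.1 l),
    ∀ p l (h : C.Inc p l),
      C.coloring.color (ψ.1 p) (ψ.2.1 l) ((hψ p l).1 h) = ψ.2.2 (C.coloring.color p l h)}
  one_mem' := ⟨fun _ _ => Iff.rfl, fun _ _ _ => rfl⟩
  mul_mem' := by
    rintro ψ θ ⟨h₁, h₂⟩ ⟨h₃, h₄⟩
    refine ⟨fun p l => (h₃ p l).trans (h₁ _ _), fun p l h => ?_⟩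
    exact (h₂ _ _ ((h₃ p l).1 h)).trans (congrArg ψ.2.2 (h₄ p l h))
  inv_mem' := by
    rintro ψ ⟨h₁, h₂⟩
    have key : ∀ p l, C.Inc p l ↔ C.Inc (ψ.1⁻¹ p) (ψ.2.1⁻¹ l) := fun p l => by
      have := h₁ (ψ.1⁻¹ p) (ψ.2.1⁻¹ l)
      rwa [Equiv.Perm.inv_def, Equiv.Perm.inv_def, Equiv.apply_symm_apply,
        Equiv.apply_symm_apply, Iff.comm] at this
    refine ⟨key, fun p l h => ?_⟩
    refine (Equiv.eq_symm_apply ψ.2.2).2 ((h₂ _ _ ((key p l).1 h)).symm.trans ?_)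
    congr 1 <;> exact Equiv.apply_symm_apply _ _

/-! ### Simplicial complexes -/

namespace AbstractSimplicialComplex

variable {V : Type*} (K : AbstractSimplicialComplex V)

/-- A facet is an inclusion-maximal face. -/
def IsFacet (s : Finset V) : Prop := Maximal (fun t : Finset V => t ∈ K.faces) s

/-- The complex has dimension `d`: the largest faces have `d + 1` vertices. -/
def HasDimension (d : ℕ) : Prop := IsGreatest {m : ℕ | ∃ s ∈ K.faces, s.card = m} (d + 1)

/-- Each pair of vertices forms an edge. -/
def IsTwoNeighborly : Prop := ∀ s : Finset V, s.card = 2 → s ∈ K.faces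

/-- The group of simplicial automorphisms. -/
def Aut : Subgroup (Equiv.Perm V) where
  carrier := {σ | ∀ s : Finset V, s ∈ K.faces ↔ s.map σ.toEmbedding ∈ K.faces}
  one_mem' := fun s => by
    have : s.map (Equiv.toEmbedding (1 : Equiv.Perm V)) = s := Finset.map_refl
    rw [this]
  mul_mem' := by
    intro σ τ hσ hτ s
    rw [hτ s, hσ, Finset.map_map]
    rfl
  inv_mem' := by
    intro σ hσ s
    rw [hσ (s.map _), Finset.map_map]
    have : (Equiv.toEmbedding σ⁻¹).trans σ.toEmbedding = Function.Embedding.refl V := by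
      ext v
      exact Equiv.apply_symm_apply σ v
    rw [this, Finset.map_refl]

/-- The geometric realization: formal convex combinations of vertices supported on a face. -/
def Realization : Type _ :=
  {t : V →₀ ℝ // t.support ∈ K.faces ∧ (∀ v, 0 ≤ t v) ∧ ∑ v ∈ t.support, t v = 1}

/-- The closed simplex of the realization spanned by a set `s` of vertices. -/
def closedSimplex (s : Finset V) : Set K.Realization := {x | x.1.support ⊆ s}

/-- Barycentric coordinates on a closed simplex. -/
def coords (s : Finset V) (x : K.closedSimplex s) : V → ℝ := fun v => x.1.1 v

/-- The weak topology: a set is open iff its intersection with the closed simplex of each face `s`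
is open in that simplex, which carries its Euclidean topology. -/
instance : TopologicalSpace K.Realization :=
  ⨆ s : {s : Finset V // s ∈ K.faces},
    TopologicalSpace.coinduced (Subtype.val : K.closedSimplex s.1 → K.Realization)
      (TopologicalSpace.induced (K.coords s.1) inferInstance)

/-- A copy of a configuration inside a complex: the points are distinct vertices, the lines are
distinct facets, and a facet consists exactly of the points on the corresponding line. -/
structure ConfigurationCopy {k : ℕ} {P L : Type*} [Finite P] [Finite L]
    (C : KConfiguration k P L) where
  /-- The vertex representing a point. -/
  vertex : P ↪ V
  /-- The facet representing a line. -/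
  facet : L ↪ Finset V
  isFacet : ∀ l, K.IsFacet (facet l)
  coe_facet : ∀ l, (facet l : Set V) = vertex '' {p | C.Inc p l}

end AbstractSimplicialComplex

/-! ### The lattice `A_k`, the complex `W_k` and its quotients -/

/-- The lattice `A_k` of integer vectors with `k + 1` coordinates of sum zero. -/
def latticeA (k : ℕ) : AddSubgroup (Fin (k + 1) → ℤ) where
  carrier := {x | ∑ i, x i = 0}
  zero_mem' := by simp
  add_mem' := by
    intro x y hx hy
    simp only [Set.mem_ofPred_eq] at hx hy ⊢
    simp [Finset.sum_add_distrib, hx, hy]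
  neg_mem' := by
    intro x hx
    simp only [Set.mem_ofPred_eq] at hx ⊢
    simp [hx]

/-- Half the `ℓ¹`-distance on `A_k`. -/
def latticeDist {k : ℕ} (x y : latticeA k) : ℚ := (∑ i, |(x.1 i : ℚ) - y.1 i|) / 2

/-- The root vector `e_j - e_i` of `A_k` (zero if `i = j`). -/
def rootVec {k : ℕ} (i j : Fin (k + 1)) : latticeA k :=
  ⟨Pi.single j 1 - Pi.single i 1, by simp [latticeA, Finset.sum_sub_distrib]⟩

/-- The Rips complex `W_k` of diameter 1 on `A_k`. -/
def complexW (k : ℕ) : AbstractSimplicialComplex (latticeA k) where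
  faces := {F | F.Nonempty ∧ ∀ x ∈ F, ∀ y ∈ F, x ≠ y → latticeDist x y = 1}
  isRelLowerSet_faces := fun _ hs =>
    ⟨hs.1, fun _ hts ht => ⟨ht, fun x hx y hy => hs.2 x (hts hx) y (hts hy)⟩⟩
  singleton_mem := fun v => ⟨Finset.singleton_nonempty v, fun x hx y hy h => by
    rw [Finset.mem_singleton] at hx hy
    exact absurd (hx.trans hy.symm) h⟩

/-- The complex `W_k / H` on the vertex set `A_k / H`: its faces are the images of the faces of
`W_k`. -/
def quotientComplex {k : ℕ} (H : AddSubgroup (latticeA k)) :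
    AbstractSimplicialComplex (latticeA k ⧸ H) where
  faces := {s | ∃ F ∈ (complexW k).faces,
    (s : Set (latticeA k ⧸ H)) = (QuotientAddGroup.mk : latticeA k → latticeA k ⧸ H) '' F}
  isRelLowerSet_faces := by
    classical
    rintro s ⟨F, hF, hs⟩
    refine ⟨?_, fun t hts ht => ?_⟩
    · rw [← Finset.coe_nonempty, hs]
      exact (Finset.coe_nonempty.2 hF.1).image _
    · have hsub : (t : Set (latticeA k ⧸ H)) ⊆
          (QuotientAddGroup.mk : latticeA k → latticeA k ⧸ H) '' F := by
        rw [← hs]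
        exact_mod_cast hts
      obtain ⟨F', hF', hF't⟩ := Finset.subset_set_image_iff.1 hsub
      refine ⟨F', ?_, by rw [← hF't, Finset.coe_image]⟩
      have hle : F' ≤ F := fun x hx => hF' hx
      refine ((complexW k).isRelLowerSet_faces hF).2 hle ?_
      rw [← hF't] at ht
      exact Finset.image_nonempty.1 ht
  singleton_mem := fun v => by
    obtain ⟨x, rfl⟩ := QuotientAddGroup.mk_surjective v
    exact ⟨{x}, (complexW k).singleton_mem x, by simp⟩

/-- `W_k / H` is a genuine quotient of `W_k`: the quotient map is injective on each face, and two
faces have the same image only if they lie in the same orbit under translation by `H`. -/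
def IsSimplicialQuotient {k : ℕ} (H : AddSubgroup (latticeA k)) : Prop :=
  (∀ F ∈ (complexW k).faces,
    Set.InjOn (QuotientAddGroup.mk : latticeA k → latticeA k ⧸ H) F) ∧
  ∀ F ∈ (complexW k).faces, ∀ F' ∈ (complexW k).faces,
    (QuotientAddGroup.mk : latticeA k → latticeA k ⧸ H) '' F =
      (QuotientAddGroup.mk : latticeA k → latticeA k ⧸ H) '' F' →
    ∃ h ∈ H, (F' : Set (latticeA k)) = (fun x => h + x) '' F

/-- The labelings of `A_k` by points of `C` that follow the rule
`ℓ(u - e_i + e_j) = φ_j (φ_i (ℓ(u)))` for distinct colors `i`, `j`. -/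
def ColoredConfiguration.IsLabeling {k : ℕ} {P L : Type*} [Finite P] [Finite L]
    (C : ColoredConfiguration (k + 1) P L) (lab : latticeA k → P) : Prop :=
  ∀ (u : latticeA k) (i j : Fin (k + 1)), i ≠ j →
    (Sum.inl (lab (u + rootVec i j)) : P ⊕ L) =
      C.coloring.phi j (C.coloring.phi i (Sum.inl (lab u)))

/-! ### The root lattice -/

section Lattice

variable {k : ℕ}

/-! The 6-cycle property can be rewritten as `φ_j φ_i φ_m φ_j = φ_m φ_i` (`phi_comm`). Together with
`φ_j φ_j = id` this says that the permutations `x i j = φ_j φ_i` of points and lines satisfy the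
additive relations of the roots `e_j - e_i`, in both orders of multiplication. Such a family extends
to an action of the lattice (`exists_latticeHom`), and a labeling is an orbit map of this action. It
is unique because the roots generate the lattice. Since translates of labelings are labelings,
uniqueness also shows that the fibers of a labeling are the cosets of its period group `H`;
connectedness of the incidence graph makes it surjective.

Two points on at most one line and proper coloring force zero and the roots to have distinct labels
around every lattice point (`rootVec_injective`). The resulting property `SeparatesRoots H` suffices
for the simplicial quotient and for the computation of the fundamental group.

Pairwise adjacency in `W_k` forces a face into `{u + e_b}` or `{u - e_a}`. Under the labeling the
first kind becomes the points of a line, the second the points `φ_c φ_a p` with `p` and `c` fixed.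
The latter stand for the lines through a point; by the 6-cycle property `c` may always be taken to
be `0`.

For the fundamental group, the vertices of the universal cover are modeled by homotopy classes of
paths from the base vertex. Appending edges along roots obeys the root relations because triangles
are filled, so `A_k` acts on these classes. The action is transitive because every path is homotopic
to an edge path (`path_induction`). It is free because each lattice coordinate is an integer cocycle
on the edges, hence gives a map to the circle whose winding number recovers that coordinate
(`exists_winding`). The elements of `A_k` that lead back to the base vertex form `H`, so `H` is the
fundamental group. As `A_k / H` is finite, `H` is free of rank `k`. -/

theorem latticeA_sum (x : latticeA k) : ∑ i, x.1 i = 0 := x.2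

theorem rootVec_apply (i j m : Fin (k + 1)) :
    (rootVec i j : latticeA k).1 m = (if m = j then 1 else 0) - (if m = i then 1 else 0) := by
  simp [rootVec, Pi.single_apply]

@[simp]
theorem rootVec_self (i : Fin (k + 1)) : rootVec i i = (0 : latticeA k) :=
  Subtype.ext (by simp [rootVec])

theorem rootVec_add (i j m : Fin (k + 1)) :
    rootVec i j + rootVec j m = (rootVec i m : latticeA k) :=
  Subtype.ext (by simp [rootVec])

/-- The terms `-a_j e_0` cancel because the coordinates of `a` sum to zero. Hence the roots based at
`0` generate the lattice. -/
theorem sum_smul_rootVec (a : latticeA k) : ∑ j, a.1 j • rootVec 0 j = a := by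
  refine Subtype.ext (funext fun m => ?_)
  have h : ((∑ j, a.1 j • rootVec 0 j : latticeA k) : Fin (k + 1) → ℤ) m =
      ∑ j, a.1 j * ((if m = j then 1 else 0) - (if m = 0 then 1 else 0)) := by
    rw [AddSubgroup.val_finsetSum, Finset.sum_apply]
    refine Finset.sum_congr rfl fun j _ => ?_
    rw [← rootVec_apply]
    simp
  rw [h]
  simp only [mul_sub, Finset.sum_sub_distrib, ← Finset.sum_mul, latticeA_sum a]
  simp

/-- A set of lattice points that contains a point and is closed under adding roots is everything. -/
theorem root_induction {p : latticeA k → Prop} {v₀ : latticeA k} (h₀ : p v₀)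
    (hstep : ∀ u i j, i ≠ j → p u → p (u + rootVec i j)) (v : latticeA k) : p v := by
  -- Demanding an equivalence makes the good translations a subgroup; the backward direction for
  -- `rootVec 0 j` is a step along `rootVec j 0`.
  let S : AddSubgroup (latticeA k) :=
    { carrier := {a | ∀ u, p u ↔ p (u + a)}
      zero_mem' := fun u => by simp
      add_mem' := fun {a b} ha hb u => by rw [← add_assoc, ← hb, ← ha]
      neg_mem' := fun {a} ha u => by rw [ha (u + -a), neg_add_cancel_right] }
  have hS : ∀ j, rootVec 0 j ∈ S := fun j u => by
    rcases eq_or_ne 0 j with rfl | hj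
    · simp
    · refine ⟨hstep u 0 j hj, fun h => ?_⟩
      simpa [add_assoc, rootVec_add] using hstep _ j 0 hj.symm h
  have hv : v - v₀ ∈ S := by
    rw [← sum_smul_rootVec (v - v₀)]
    exact S.sum_mem fun j _ => S.zsmul_mem (hS j) _
  simpa using (hv v₀).1 h₀

/-- A family of group elements that satisfies the relations of the roots extends to the lattice. -/
theorem exists_latticeHom {G : Type*} [Group G] (x : Fin (k + 1) → Fin (k + 1) → G)
    (h₁ : ∀ i j m, x i j * x j m = x i m) (h₂ : ∀ i j m, x j m * x i j = x i m) :
    ∃ D : Multiplicative (latticeA k) →* G,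
      ∀ i j, D (Multiplicative.ofAdd (rootVec i j)) = x i j := by
  have h0 : ∀ i, x i i = 1 := fun i => by simpa using h₁ i i i
  have hinv : ∀ i j, x i j = (x j i)⁻¹ := fun i j => by
    rw [eq_inv_iff_mul_eq_one, h₁, h0]
  -- Both products of `x i 0` and `x 0 j` equal `x i j`, so they commute, and `x i 0` is the inverse
  -- of `x 0 i`.
  have hcomm : ∀ i j, Commute (x 0 i) (x 0 j) := fun i j => by
    have : Commute (x i 0) (x 0 j) := (h₁ i 0 j).trans (h₂ i 0 j).symm
    rw [hinv] at this
    exact Commute.inv_left_iff.1 this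
  -- The commuting elements `x 0 j` define a homomorphism on all of `ℤ^(k+1)`, which is then
  -- restricted to the lattice; `e_j - e_i` goes to `x 0 j * x i 0 = x i j`.
  let F : (Fin (k + 1) → Multiplicative ℤ) →* G :=
    MonoidHom.noncommPiCoprod (fun j => zpowersHom G (x 0 j)) fun i j _ a b => by
      simp only [zpowersHom_apply]
      exact ((hcomm i j).zpow_left _).zpow_right _
  have hF : ∀ j, F (Pi.mulSingle j (Multiplicative.ofAdd 1)) = x 0 j := fun j => by
    refine (MonoidHom.noncommPiCoprod_mulSingle _ _ _).trans ?_
    simp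
  let ι : Multiplicative (latticeA k) →* (Fin (k + 1) → Multiplicative ℤ) :=
    { toFun := fun a j => Multiplicative.ofAdd (a.toAdd.1 j)
      map_one' := rfl
      map_mul' := fun _ _ => rfl }
  refine ⟨F.comp ι, fun i j => ?_⟩
  have : ι (Multiplicative.ofAdd (rootVec i j)) =
      Pi.mulSingle j (Multiplicative.ofAdd 1) * (Pi.mulSingle i (Multiplicative.ofAdd 1))⁻¹ := by
    funext m
    change Multiplicative.ofAdd ((rootVec i j : latticeA k).1 m) = _
    rw [rootVec_apply]
    rw [Pi.mul_apply, Pi.inv_apply, Pi.mulSingle_apply, Pi.mulSingle_apply]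
    split_ifs <;> rfl
  rw [MonoidHom.comp_apply, this, map_mul, map_inv, hF, hF, ← hinv, h₂]

/-! ### Distance one and the faces of `W_k` -/

theorem latticeDist_add_rootVec (x : latticeA k) {i j : Fin (k + 1)} (h : i ≠ j) :
    latticeDist x (x + rootVec i j) = 1 := by
  have : ∀ m, |(x.1 m : ℚ) - (x + rootVec i j).1 m| =
      (if m = j then 1 else 0) + (if m = i then 1 else 0) := fun m => by
    have : (x + rootVec i j).1 m = x.1 m + (rootVec i j : latticeA k).1 m := rfl
    rw [this, rootVec_apply]
    by_cases h1 : m = j <;> by_cases h2 : m = i <;> simp [h1, h2] <;> aesop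
  simp only [latticeDist, this, Finset.sum_add_distrib]
  norm_num

theorem exists_rootVec_of_latticeDist {x y : latticeA k} (h : latticeDist x y = 1) :
    ∃ i j, i ≠ j ∧ y = x + rootVec i j := by
  set d : latticeA k := y - x with hd
  have hy : y = x + d := by simp [hd]
  have habs : ∑ m, |d.1 m| = 2 := by
    have h1 : ∑ m, |(x.1 m : ℚ) - y.1 m| = 2 := by
      unfold latticeDist at h; linarith
    have h2 : ((∑ m, |d.1 m| : ℤ) : ℚ) = 2 := by
      rw [← h1]
      push_cast
      refine Finset.sum_congr rfl fun m _ => ?_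
      have : d.1 m = y.1 m - x.1 m := rfl
      rw [this, abs_sub_comm]
      push_cast
      rfl
    exact_mod_cast h2
  have hne : ∃ m ∈ Finset.univ, d.1 m ≠ 0 := by
    by_contra! hall
    simp only [Finset.mem_univ, true_imp_iff] at hall
    simp [hall] at habs
  obtain ⟨j, -, hj⟩ := Finset.exists_pos_of_sum_zero_of_exists_nonzero _ (latticeA_sum d) hne
  obtain ⟨i, -, hi⟩ := Finset.exists_pos_of_sum_zero_of_exists_nonzero (fun m => -d.1 m)
    (by simpa using latticeA_sum d) (by simpa using hne)
  have hij : i ≠ j := by rintro rfl; omega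
  refine ⟨i, j, hij, ?_⟩
  rw [hy]
  congr 1
  -- One positive and one negative integer entry already use up the total absolute value 2, so they
  -- are `1` and `-1` and all other entries vanish.
  have hsplit : |d.1 i| + (|d.1 j| + ∑ m ∈ (Finset.univ.erase i).erase j, |d.1 m|) = 2 := by
    rw [Finset.add_sum_erase _ (fun m => |d.1 m|) (by simp [hij.symm]),
      Finset.add_sum_erase _ (fun m => |d.1 m|) (by simp), habs]
  have hnn : ∀ m ∈ (Finset.univ.erase i).erase j, 0 ≤ |d.1 m| := fun m _ => abs_nonneg _
  have hrest := Finset.sum_nonneg hnn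
  have h1 : |d.1 j| = d.1 j := abs_of_pos hj
  have h2 : |d.1 i| = -d.1 i := abs_of_neg (by simpa using hi)
  have hzero := (Finset.sum_eq_zero_iff_of_nonneg hnn).1 (by omega)
  refine Subtype.ext (funext fun m => ?_)
  rw [rootVec_apply]
  by_cases hmj : m = j
  · subst hmj; simp [hij.symm]; omega
  · by_cases hmi : m = i
    · subst hmi; simp [hij]; omega
    · simpa [hmj, hmi] using hzero m (by simp [hmj, hmi])

theorem mem_faces_complexW_iff {F : Finset (latticeA k)} :
    F ∈ (complexW k).faces ↔ F.Nonempty ∧ ∀ x ∈ F, ∀ y ∈ F, ∃ i j, y = x + rootVec i j := by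
  refine and_congr_right fun _ => forall₂_congr fun x _ => forall₂_congr fun y _ => ⟨fun h => ?_,
    ?_⟩
  · by_cases hxy : x = y
    · exact ⟨0, 0, by simp [hxy]⟩
    · obtain ⟨i, j, -, hy⟩ := exists_rootVec_of_latticeDist (h hxy)
      exact ⟨i, j, hy⟩
  · rintro ⟨i, j, rfl⟩ hne
    refine latticeDist_add_rootVec x ?_
    rintro rfl
    simp at hne

/-- If neither the tails nor the heads agreed, nothing would cancel in `e_b - e_a - e_j + e_i`; its
`ℓ¹`-norm would be 4, too large for a root or zero. The coordinates `i`, `j`, `a`, `b` show this. -/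
theorem rootVec_sub_rootVec {i j a b c d : Fin (k + 1)} (hij : i ≠ j) (hab : a ≠ b)
    (h : rootVec a b = (rootVec i j + rootVec c d : latticeA k)) : a = i ∨ b = j := by
  by_contra! hne
  obtain ⟨h1, h2⟩ := hne
  have key : ∀ m, (if m = b then (1 : ℤ) else 0) - (if m = a then 1 else 0) =
      (if m = j then 1 else 0) - (if m = i then 1 else 0) +
      ((if m = d then 1 else 0) - (if m = c then 1 else 0)) := fun m => by
    simp only [← rootVec_apply]
    exact congrArg (fun x : latticeA k => x.1 m) h
  have ki := key i
  have kj := key j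
  have ka := key a
  have kb := key b
  simp only [h1, h2, h1.symm, h2.symm, hij, hij.symm, hab, hab.symm, if_true,
    if_false] at ki kj ka kb
  grind

/-- Every face of `W_k` lies in one of the two simplices `{u + e_b}` or `{u - e_a}`. -/
theorem face_complexW_subset {F : Finset (latticeA k)} (hF : F ∈ (complexW k).faces) :
    ∃ x ∈ F, ∃ c, (∀ y ∈ F, ∃ b, y = x + rootVec c b) ∨ (∀ y ∈ F, ∃ a, y = x + rootVec a c) := by
  obtain ⟨⟨x, hx⟩, h⟩ := mem_faces_complexW_iff.1 hF
  refine ⟨x, hx, ?_⟩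
  have compat : ∀ {i j a b}, i ≠ j → a ≠ b → x + rootVec i j ∈ F → x + rootVec a b ∈ F →
      a = i ∨ b = j := fun {i j a b} hij hab h1 h2 => by
    obtain ⟨c, d, hcd⟩ := h _ h1 _ h2
    exact rootVec_sub_rootVec hij hab (add_left_cancel (hcd.trans (add_assoc _ _ _)))
  by_cases hsing : ∀ y ∈ F, y = x
  · exact ⟨0, Or.inl fun y hy => ⟨0, by simp [hsing y hy]⟩⟩
  push Not at hsing
  obtain ⟨y, hy, hyx⟩ := hsing
  obtain ⟨i, j, rfl⟩ := h x hx y hy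
  have hij : i ≠ j := by rintro rfl; simp at hyx
  by_cases hall : ∀ z ∈ F, ∃ b, z = x + rootVec i b
  -- Otherwise some root in the face has a tail `a ≠ i` and hence the same head as `rootVec i j`. A
  -- further root cannot share its tail with both, so it shares this head.
  · exact ⟨i, Or.inl hall⟩
  push Not at hall
  obtain ⟨z, hz, hzi⟩ := hall
  obtain ⟨a, b, rfl⟩ := h x hx z hz
  have hab : a ≠ b := by rintro rfl; exact hzi i (by simp)
  have hai : a ≠ i := by rintro rfl; exact hzi b rfl
  have hbj : b = j := (compat hij hab hy hz).resolve_left hai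
  subst hbj
  refine ⟨b, Or.inr fun w hw => ?_⟩
  obtain ⟨c, d, rfl⟩ := h x hx w hw
  by_cases hcd : c = d
  · exact ⟨b, by simp [hcd]⟩
  refine ⟨c, ?_⟩
  have h3 := compat hij hcd hy hw
  have h4 := compat hab hcd hz hw
  have : d = b := by
    rcases h3 with h3 | h3
    · rcases h4 with h4 | h4
      · exact absurd (h4.symm.trans h3) hai
      · exact h4
    · exact h3
  rw [this]

theorem face_of_forall_rootVec_left {F : Finset (latticeA k)} (hne : F.Nonempty) {x : latticeA k}
    {c : Fin (k + 1)} (h : ∀ y ∈ F, ∃ b, y = x + rootVec c b) : F ∈ (complexW k).faces := by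
  refine mem_faces_complexW_iff.2 ⟨hne, fun y hy z hz => ?_⟩
  obtain ⟨b, rfl⟩ := h y hy
  obtain ⟨b', rfl⟩ := h z hz
  exact ⟨b, b', by rw [add_assoc, rootVec_add]⟩

theorem face_of_forall_rootVec_right {F : Finset (latticeA k)} (hne : F.Nonempty) {x : latticeA k}
    {c : Fin (k + 1)} (h : ∀ y ∈ F, ∃ a, y = x + rootVec a c) : F ∈ (complexW k).faces := by
  refine mem_faces_complexW_iff.2 ⟨hne, fun y hy z hz => ?_⟩
  obtain ⟨b, rfl⟩ := h y hy
  obtain ⟨b', rfl⟩ := h z hz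
  exact ⟨b', b, by rw [add_assoc, add_comm (rootVec b c), rootVec_add]⟩

end Lattice

/-! ### Labelings -/

namespace KConfiguration.EdgeColoring

variable {k : ℕ} {P L : Type*} [Finite P] [Finite L] {C : KConfiguration k P L}
  (χ : C.EdgeColoring)

theorem phi_inl_eq_inr_iff {c : Fin k} {p : P} {l : L} :
    χ.phi c (.inl p) = .inr l ↔ ∃ h : C.Inc p l, χ.color p l h = c := by
  have hs := (χ.existsUnique_line c p).choose_spec
  refine ⟨fun h => ?_, fun h => congrArg Sum.inr (hs.2 l h).symm⟩
  rw [← Sum.inr_injective h]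
  exact hs.1

theorem phi_inr_eq_inl_iff {c : Fin k} {p : P} {l : L} :
    χ.phi c (.inr l) = .inl p ↔ ∃ h : C.Inc p l, χ.color p l h = c := by
  have hs := (χ.existsUnique_point c l).choose_spec
  refine ⟨fun h => ?_, fun h => congrArg Sum.inl (hs.2 p h).symm⟩
  rw [← Sum.inl_injective h]
  exact hs.1

theorem exists_phi_inl (c : Fin k) (p : P) : ∃ l, χ.phi c (.inl p) = .inr l := ⟨_, rfl⟩

theorem exists_phi_inr (c : Fin k) (l : L) : ∃ p, χ.phi c (.inr l) = .inl p := ⟨_, rfl⟩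

theorem inc_iff_exists_phi {p : P} {l : L} : C.Inc p l ↔ ∃ c, χ.phi c (.inl p) = .inr l :=
  ⟨fun h => ⟨_, χ.phi_inl_eq_inr_iff.2 ⟨h, rfl⟩⟩, fun ⟨_, h⟩ => (χ.phi_inl_eq_inr_iff.1 h).1⟩

theorem inc_iff_exists_phi' {p : P} {l : L} : C.Inc p l ↔ ∃ c, χ.phi c (.inr l) = .inl p :=
  ⟨fun h => ⟨_, χ.phi_inr_eq_inl_iff.2 ⟨h, rfl⟩⟩, fun ⟨_, h⟩ => (χ.phi_inr_eq_inl_iff.1 h).1⟩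

@[simp]
theorem phi_phi (c : Fin k) (v : P ⊕ L) : χ.phi c (χ.phi c v) = v := by
  rcases v with p | l
  · obtain ⟨l, hl⟩ := χ.exists_phi_inl c p
    rw [hl, χ.phi_inr_eq_inl_iff, ← χ.phi_inl_eq_inr_iff, hl]
  · obtain ⟨p, hp⟩ := χ.exists_phi_inr c l
    rw [hp, χ.phi_inl_eq_inr_iff, ← χ.phi_inr_eq_inl_iff, hp]

theorem phi_injective (c : Fin k) : Function.Injective (χ.phi c) :=
  (show Function.Involutive (χ.phi c) from χ.phi_phi c).injective

theorem color_eq_of_phi_eq {a b : Fin k} {v : P ⊕ L} (h : χ.phi a v = χ.phi b v) : a = b := by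
  rcases v with p | l
  · obtain ⟨l, hl⟩ := χ.exists_phi_inl a p
    obtain ⟨h1, rfl⟩ := χ.phi_inl_eq_inr_iff.1 hl
    obtain ⟨h2, rfl⟩ := χ.phi_inl_eq_inr_iff.1 (h.symm.trans hl)
    rfl
  · obtain ⟨p, hp⟩ := χ.exists_phi_inr a l
    obtain ⟨h1, rfl⟩ := χ.phi_inr_eq_inl_iff.1 hp
    obtain ⟨h2, rfl⟩ := χ.phi_inr_eq_inl_iff.1 (h.symm.trans hp)
    rfl

/-- This is the 6-cycle relation with three involutions moved to the other side; when two of the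
colors coincide it follows from involutivity alone. -/
theorem SixCycle.phi_comm {χ : C.EdgeColoring} (h : χ.SixCycle) (i j m : Fin k) (v : P ⊕ L) :
    χ.phi j (χ.phi i (χ.phi m (χ.phi j v))) = χ.phi m (χ.phi i v) := by
  by_cases hij : i = j
  · subst hij; simp
  by_cases hjm : j = m
  · subst hjm; simp
  by_cases him : i = m
  · subst him; simp
  have := h (χ.phi j v) m i j (Ne.symm him) (Ne.symm hjm) hij
  calc _ = χ.phi m (χ.phi i (χ.phi j (χ.phi j (χ.phi i (χ.phi m
        (χ.phi j (χ.phi i (χ.phi m (χ.phi j v))))))))) := by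
        rw [phi_phi, phi_phi, phi_phi]
    _ = _ := by rw [this, phi_phi]

end KConfiguration.EdgeColoring

/-! ### Existence, uniqueness and periods of labelings -/

namespace ColoredConfiguration

variable {k : ℕ} {P L : Type*} [Finite P] [Finite L] (C : ColoredConfiguration (k + 1) P L)

/-- The involution `φ_c` as a permutation. -/
noncomputable def phiPerm (c : Fin (k + 1)) : Equiv.Perm (P ⊕ L) :=
  Function.Involutive.toPerm (C.coloring.phi c) (C.coloring.phi_phi c)

/-- For each color, the point of that color on a line. -/
noncomputable def pointOn (c : Fin (k + 1)) (l : L) : P :=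
  (C.coloring.existsUnique_point c l).choose

theorem inl_pointOn (c : Fin (k + 1)) (l : L) :
    (Sum.inl (C.pointOn c l) : P ⊕ L) = C.coloring.phi c (.inr l) := rfl

theorem pointOn_injective (c : Fin (k + 1)) : Function.Injective (C.pointOn c) := fun l l' h => by
  have := congrArg (Sum.inl : P → P ⊕ L) h
  rw [inl_pointOn, inl_pointOn] at this
  exact Sum.inr_injective (C.coloring.phi_injective c this)

variable {C}

theorem eq_of_isLabeling {lab lab' : latticeA k → P} (h : C.IsLabeling lab)
    (h' : C.IsLabeling lab') {v₀ : latticeA k} (h₀ : lab v₀ = lab' v₀) : lab = lab' := by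
  refine funext (root_induction (p := fun v => lab v = lab' v) h₀ fun u i j hij hu => ?_)
  exact Sum.inl_injective ((h u i j hij).trans ((h' u i j hij).trans (by rw [hu])).symm)

variable (C) in
theorem exists_isLabeling (v₀ : latticeA k) (p₀ : P) :
    ∃ lab : latticeA k → P, C.IsLabeling lab ∧ lab v₀ = p₀ := by
  obtain ⟨D, hD⟩ := exists_latticeHom (fun i j => C.phiPerm j * C.phiPerm i)
    (fun i j m => Equiv.ext fun v => C.sixCycle.phi_comm i j m v)
    (fun i j m => Equiv.ext fun v => congrArg (C.coloring.phi m) (C.coloring.phi_phi j _))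
  have hstep : ∀ u i j, D (.ofAdd (u + rootVec i j - v₀)) (.inl p₀) =
      C.coloring.phi j (C.coloring.phi i (D (.ofAdd (u - v₀)) (.inl p₀))) := fun u i j => by
    rw [add_sub_right_comm, add_comm (u - v₀), ofAdd_add, map_mul, hD]
    rfl
  -- A root step applies two of the maps `φ`, so points stay points.
  have hex : ∀ v, ∃ p, D (.ofAdd (v - v₀)) (.inl p₀) = .inl p := by
    refine root_induction (v₀ := v₀) ⟨p₀, by simp⟩ fun u i j _ ⟨p, hp⟩ => ?_
    rw [hstep, hp]
    exact ⟨_, rfl⟩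
  choose lab hlab using hex
  refine ⟨lab, fun u i j _ => by rw [← hlab, ← hlab, hstep], ?_⟩
  have := hlab v₀
  simp only [sub_self, ofAdd_zero, map_one, Equiv.Perm.coe_one, id] at this
  exact (Sum.inl_injective this).symm

namespace IsLabeling

variable {lab : latticeA k → P} (h : C.IsLabeling lab)

include h

theorem apply_add (u : latticeA k) (i j : Fin (k + 1)) :
    (Sum.inl (lab (u + rootVec i j)) : P ⊕ L) =
      C.coloring.phi j (C.coloring.phi i (Sum.inl (lab u))) := by
  by_cases hij : i = j
  · subst hij; simp
  · exact h u i j hij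

theorem translate (w : latticeA k) : C.IsLabeling (fun u => lab (w + u)) := fun u i j hij => by
  simpa only [add_assoc] using h (w + u) i j hij

/-- The two translated labelings agree at `0`, hence everywhere by uniqueness. This makes the fibers
cosets of the periods. -/
theorem add_eq_add {v w : latticeA k} (hvw : lab v = lab w) (u : latticeA k) :
    lab (v + u) = lab (w + u) :=
  congrFun (eq_of_isLabeling (h.translate v) (h.translate w) (v₀ := 0) (by simpa using hvw)) u

theorem surjective : Function.Surjective lab := by
  -- The invariant along a walk in the incidence graph: a visited point is a label, and every point
  -- on a visited line is a label. A line reached from `lab u` along color `b` has `lab (u + rootVec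
  -- b c)` as its point of color `c`.
  have key : ∀ v, C.graph.Reachable (.inl (lab 0)) v →
      (∀ p, v = .inl p → p ∈ Set.range lab) ∧
      (∀ l, v = .inr l → ∀ c, C.pointOn c l ∈ Set.range lab) := by
    intro v hv
    induction (SimpleGraph.reachable_iff_reflTransGen _ _).1 hv with
    | refl => exact ⟨fun p hp => ⟨0, Sum.inl_injective hp⟩, fun l hl => by simp at hl⟩
    | @tail v w hv' hvw ih =>
      have ih := ih ((SimpleGraph.reachable_iff_reflTransGen _ _).2 hv')
      rcases v with p | l <;> rcases w with p' | l'
      · exact hvw.elim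
      · refine ⟨fun p hp => by simp at hp, fun l hl c => ?_⟩
        obtain rfl := Sum.inr_injective hl
        obtain ⟨u, hu⟩ := ih.1 p rfl
        obtain ⟨b, hb⟩ := C.coloring.inc_iff_exists_phi.1 (show C.Inc p l' from hvw)
        refine ⟨u + rootVec b c, Sum.inl_injective (β := L) ?_⟩
        rw [h.apply_add, hu, hb, inl_pointOn]
      · refine ⟨fun p hp => ?_, fun l hl => by simp at hl⟩
        obtain rfl := Sum.inl_injective hp
        obtain ⟨b, hb⟩ := C.coloring.inc_iff_exists_phi'.1 (show C.Inc p' l from hvw)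
        rw [← inl_pointOn] at hb
        rw [← Sum.inl_injective hb]
        exact ih.2 l rfl b
      · exact hvw.elim
  exact fun p => (key (.inl p) (C.connected.preconnected _ _)).1 p rfl

/-- In the generic case both `lab u` and the common label lie on the two lines `φ_i (lab u)` and
`φ_a (lab u)`. If the points coincide then `i = j`, if the lines coincide then `i = a`, and these
cases are treated first. -/
theorem rootVec_injective (u : latticeA k) {i j a b : Fin (k + 1)}
    (hl : lab (u + rootVec i j) = lab (u + rootVec a b)) :
    (rootVec i j : latticeA k) = rootVec a b := by
  have hphi := congrArg (Sum.inl : P → P ⊕ L) hl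
  rw [h.apply_add, h.apply_add] at hphi
  set χ := C.coloring
  by_cases hia : i = a
  · subst hia
    rw [χ.color_eq_of_phi_eq hphi]
  have eq_of : ∀ {c d : Fin (k + 1)} {v : P ⊕ L}, v = χ.phi d (χ.phi c v) → c = d :=
    fun {c d v} hv => χ.color_eq_of_phi_eq (v := v) (by
      conv_rhs => rw [hv]
      rw [χ.phi_phi])
  by_cases hij : i = j
  · subst hij
    rw [χ.phi_phi] at hphi
    rw [eq_of hphi, rootVec_self, rootVec_self]
  obtain ⟨l, hli⟩ := χ.exists_phi_inl i (lab u)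
  obtain ⟨l', hla⟩ := χ.exists_phi_inl a (lab u)
  obtain ⟨q, hq⟩ := χ.exists_phi_inr j l
  rw [hli, hla, hq] at hphi
  have h1 : C.Inc (lab u) l := χ.inc_iff_exists_phi.2 ⟨_, hli⟩
  have h2 : C.Inc (lab u) l' := χ.inc_iff_exists_phi.2 ⟨_, hla⟩
  have h3 : C.Inc q l := χ.inc_iff_exists_phi'.2 ⟨_, hq⟩
  have h4 : C.Inc q l' := χ.inc_iff_exists_phi'.2 ⟨_, hphi.symm⟩
  rcases C.eq_or_eq h1 h2 h3 h4 with h5 | h5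
  · rw [← h5, ← hli] at hq
    exact absurd (eq_of hq.symm) hij
  · rw [← h5, ← hli] at hla
    exact absurd (χ.color_eq_of_phi_eq hla).symm hia

/-- The period lattice of a labeling. -/
def periods : AddSubgroup (latticeA k) where
  carrier := {v | lab v = lab 0}
  zero_mem' := rfl
  add_mem' := fun {v w} hv hw => by
    change lab (v + w) = lab 0
    rw [h.add_eq_add hv, zero_add]
    exact hw
  neg_mem' := fun {v} hv => by
    change lab (-v) = lab 0
    simpa using (h.add_eq_add hv (-v)).symm

theorem mk_eq_mk_iff {v w : latticeA k} :
    (QuotientAddGroup.mk v : latticeA k ⧸ h.periods) = QuotientAddGroup.mk w ↔ lab v = lab w := by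
  rw [QuotientAddGroup.eq]
  change lab (-v + w) = lab 0 ↔ _
  constructor <;> intro hvw
  · simpa [add_comm w v] using (h.add_eq_add hvw v).symm
  · simpa [add_comm] using (h.add_eq_add hvw (-v)).symm

/-- The labeling identifies the vertices of the quotient complex with the points. -/
noncomputable def vertexEquiv : latticeA k ⧸ h.periods ≃ P :=
  Equiv.ofBijective
    (Quotient.lift lab fun v w hvw => h.mk_eq_mk_iff.1 (Quotient.sound hvw))
    ⟨fun x y => by
      induction x using QuotientAddGroup.induction_on
      induction y using QuotientAddGroup.induction_on
      exact h.mk_eq_mk_iff.2, fun p => (h.surjective p).imp' QuotientAddGroup.mk fun _ hv => hv⟩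

@[simp]
theorem vertexEquiv_mk (v : latticeA k) : h.vertexEquiv (QuotientAddGroup.mk v) = lab v := rfl

end IsLabeling

end ColoredConfiguration

/-! ### Quotients of `W_k` in which roots stay distinct -/

/-- The roots and zero are pairwise distinct modulo `H`. -/
def SeparatesRoots {k : ℕ} (H : AddSubgroup (latticeA k)) : Prop :=
  ∀ i j a b : Fin (k + 1), (QuotientAddGroup.mk (rootVec i j) : latticeA k ⧸ H) =
    QuotientAddGroup.mk (rootVec a b) → (rootVec i j : latticeA k) = rootVec a b

theorem ColoredConfiguration.IsLabeling.separatesRoots {k : ℕ} {P L : Type*} [Finite P] [Finite L]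
    {C : ColoredConfiguration (k + 1) P L} {lab : latticeA k → P} (h : C.IsLabeling lab) :
    SeparatesRoots h.periods := fun i j a b hr =>
  h.rootVec_injective 0 (by simpa using h.mk_eq_mk_iff.1 hr)

section SeparatesRoots

variable {k : ℕ} {H : AddSubgroup (latticeA k)}

/-- For the converse, each vertex is lifted along a chosen root with the common index `c`; lifts
chosen this way automatically form a face of `W_k`, so `H` is arbitrary here. -/
theorem mem_faces_quotientComplex_iff {s : Finset (latticeA k ⧸ H)} :
    s ∈ (quotientComplex H).faces ↔ s.Nonempty ∧ ∃ (x : latticeA k) (c : Fin (k + 1)),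
      (∀ v ∈ s, ∃ b, v = QuotientAddGroup.mk (x + rootVec c b)) ∨
      (∀ v ∈ s, ∃ a, v = QuotientAddGroup.mk (x + rootVec a c)) := by
  classical
  constructor
  · rintro hs
    refine ⟨((quotientComplex H).isRelLowerSet_faces hs).1, ?_⟩
    obtain ⟨F, hF, hs⟩ := hs
    have hmem : ∀ v ∈ s, ∃ y ∈ F, QuotientAddGroup.mk y = v := fun v hv => by
      have : v ∈ (s : Set (latticeA k ⧸ H)) := hv
      rw [hs] at this
      exact this
    obtain ⟨x, -, c, h | h⟩ := face_complexW_subset hF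
    · refine ⟨x, c, Or.inl fun v hv => ?_⟩
      obtain ⟨y, hy, rfl⟩ := hmem v hv
      obtain ⟨b, rfl⟩ := h y hy
      exact ⟨b, rfl⟩
    · refine ⟨x, c, Or.inr fun v hv => ?_⟩
      obtain ⟨y, hy, rfl⟩ := hmem v hv
      obtain ⟨b, rfl⟩ := h y hy
      exact ⟨b, rfl⟩
  · rintro ⟨hne, x, c, h⟩
    rcases h with h | h <;> choose! f hf using h
    · refine ⟨s.image fun v => x + rootVec c (f v), face_of_forall_rootVec_left
        (hne.image _) (x := x) (c := c) fun y hy => ?_, ?_⟩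
      · obtain ⟨v, -, rfl⟩ := Finset.mem_image.1 hy
        exact ⟨f v, rfl⟩
      · rw [Finset.coe_image, Set.image_image]
        exact (Set.image_id _).symm.trans (Set.image_congr hf)
    · refine ⟨s.image fun v => x + rootVec (f v) c, face_of_forall_rootVec_right
        (hne.image _) (x := x) (c := c) fun y hy => ?_, ?_⟩
      · obtain ⟨v, -, rfl⟩ := Finset.mem_image.1 hy
        exact ⟨f v, rfl⟩
      · rw [Finset.coe_image, Set.image_image]
        exact (Set.image_id _).symm.trans (Set.image_congr hf)

theorem card_le_of_mem_faces_quotientComplex {s : Finset (latticeA k ⧸ H)}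
    (hs : s ∈ (quotientComplex H).faces) : s.card ≤ k + 1 := by
  classical
  obtain ⟨-, x, c, h | h⟩ := mem_faces_quotientComplex_iff.1 hs
  · have : s ⊆ Finset.univ.image fun b => QuotientAddGroup.mk (x + rootVec c b) := fun v hv => by
      obtain ⟨b, rfl⟩ := h v hv
      simp
    simpa using (Finset.card_le_card this).trans Finset.card_image_le
  · have : s ⊆ Finset.univ.image fun a => QuotientAddGroup.mk (x + rootVec a c) := fun v hv => by
      obtain ⟨b, rfl⟩ := h v hv
      simp
    simpa using (Finset.card_le_card this).trans Finset.card_image_le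

variable (hH : SeparatesRoots H)

include hH

theorem SeparatesRoots.add_rootVec_inj {x : latticeA k} {i j a b : Fin (k + 1)}
    (h : (QuotientAddGroup.mk (x + rootVec i j) : latticeA k ⧸ H) =
      QuotientAddGroup.mk (x + rootVec a b)) : (rootVec i j : latticeA k) = rootVec a b := by
  refine hH _ _ _ _ ?_
  rw [QuotientAddGroup.mk_add, QuotientAddGroup.mk_add] at h
  exact add_left_cancel h

theorem SeparatesRoots.injOn {F : Finset (latticeA k)} (hF : F ∈ (complexW k).faces) :
    Set.InjOn (QuotientAddGroup.mk : latticeA k → latticeA k ⧸ H) F := by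
  intro y hy z hz hyz
  obtain ⟨i, j, rfl⟩ := (mem_faces_complexW_iff.1 hF).2 y hy z hz
  have := hH.add_rootVec_inj (x := y) (i := 0) (j := 0) (a := i) (b := j) (by simpa using hyz)
  rw [← this]
  simp

/-- Matching one vertex `x` of `F` with a congruent `x'` of `F'` determines the translation. All
other vertices are a root away from these, and congruent roots are equal. -/
theorem SeparatesRoots.isSimplicialQuotient : IsSimplicialQuotient H := by
  refine ⟨fun F hF => hH.injOn hF, ?_⟩
  have key : ∀ F ∈ (complexW k).faces, ∀ F' ∈ (complexW k).faces, ∀ x ∈ F, ∀ x' ∈ F',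
      (QuotientAddGroup.mk x : latticeA k ⧸ H) = QuotientAddGroup.mk x' →
      (QuotientAddGroup.mk : latticeA k → latticeA k ⧸ H) '' F ⊆
        (QuotientAddGroup.mk : latticeA k → latticeA k ⧸ H) '' F' →
      (fun y => (x' - x) + y) '' (F : Set (latticeA k)) ⊆ F' := by
    rintro F hF F' hF' x hx x' hx' hxx hsub _ ⟨y, hy, rfl⟩
    obtain ⟨y', hy', hyy⟩ := hsub ⟨y, hy, rfl⟩
    obtain ⟨i, j, rfl⟩ := (mem_faces_complexW_iff.1 hF).2 x hx y hy
    obtain ⟨a, b, rfl⟩ := (mem_faces_complexW_iff.1 hF').2 x' hx' y' hy'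
    have : (rootVec a b : latticeA k) = rootVec i j := by
      refine hH _ _ _ _ ?_
      rw [QuotientAddGroup.mk_add, QuotientAddGroup.mk_add, hxx] at hyy
      exact add_left_cancel hyy
    have h2 : x' - x + (x + rootVec i j) = x' + rootVec a b := by rw [this]; abel
    change x' - x + (x + rootVec i j) ∈ (F' : Set (latticeA k))
    rw [h2]
    exact hy'
  intro F hF F' hF' himg
  obtain ⟨x, hx⟩ := hF.1
  obtain ⟨x', hx', hxx⟩ := himg.subset ⟨x, hx, rfl⟩
  refine ⟨x' - x, ?_, ?_⟩
  · rw [sub_eq_neg_add]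
    exact QuotientAddGroup.eq.1 hxx.symm
  · refine subset_antisymm (fun y' hy' => ?_) (key F hF F' hF' x hx x' hx' hxx.symm himg.subset)
    refine ⟨(x - x') + y', key F' hF' F hF x' hx' x hx hxx himg.superset ⟨y', hy', rfl⟩, ?_⟩
    change x' - x + (x - x' + y') = y'
    abel

end SeparatesRoots

/-! ### The facets of the quotient complex -/

namespace ColoredConfiguration.IsLabeling

variable {k : ℕ} {P L : Type*} [Finite P] [Finite L] {C : ColoredConfiguration (k + 1) P L}
  {lab : latticeA k → P} (h : C.IsLabeling lab)

include h

theorem finite_vertices : Finite (latticeA k ⧸ h.periods) := Finite.of_equiv P h.vertexEquiv.symm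

theorem mem_faces_iff {s : Finset (latticeA k ⧸ h.periods)} :
    s ∈ (quotientComplex h.periods).faces ↔ s.Nonempty ∧
      ((∃ l, ∀ v ∈ s, C.Inc (h.vertexEquiv v) l) ∨
      ∃ p c, ∀ v ∈ s, ∃ a, (Sum.inl (h.vertexEquiv v) : P ⊕ L) =
        C.coloring.phi c (C.coloring.phi a (.inl p))) := by
  rw [mem_faces_quotientComplex_iff]
  refine and_congr_right fun _ => ⟨?_, ?_⟩
  · rintro ⟨x, c, hs | hs⟩
    · obtain ⟨l, hl⟩ := C.coloring.exists_phi_inl c (lab x)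
      refine Or.inl ⟨l, fun v hv => ?_⟩
      obtain ⟨b, rfl⟩ := hs v hv
      refine C.coloring.inc_iff_exists_phi'.2 ⟨b, ?_⟩
      rw [h.vertexEquiv_mk, h.apply_add, hl]
    · refine Or.inr ⟨lab x, c, fun v hv => ?_⟩
      obtain ⟨a, rfl⟩ := hs v hv
      exact ⟨a, by rw [h.vertexEquiv_mk, h.apply_add]⟩
  · rintro (⟨l, hl⟩ | ⟨p, c, hs⟩)
    -- Any point of `l` would do as base; from the one of color `0`, `φ_0` leads back to `l`.
    · obtain ⟨x, hx⟩ := h.surjective (C.pointOn 0 l)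
      refine ⟨x, 0, Or.inl fun v hv => ?_⟩
      obtain ⟨b, hb⟩ := C.coloring.inc_iff_exists_phi'.1 (hl v hv)
      refine ⟨b, h.vertexEquiv.injective (Sum.inl_injective (β := L) ?_)⟩
      rw [h.vertexEquiv_mk, h.apply_add, hx, inl_pointOn, C.coloring.phi_phi, hb]
    · obtain ⟨x, rfl⟩ := h.surjective p
      refine ⟨x, c, Or.inr fun v hv => ?_⟩
      obtain ⟨a, ha⟩ := hs v hv
      refine ⟨a, h.vertexEquiv.injective (Sum.inl_injective (β := L) ?_)⟩
      rw [h.vertexEquiv_mk, h.apply_add, ha]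

/-- The facet whose vertices are the points on a line. -/
noncomputable def lineFacet (l : L) : Finset (latticeA k ⧸ h.periods) :=
  (Set.toFinite (h.vertexEquiv.symm '' {p | C.Inc p l})).toFinset

/-- The facet whose vertices represent the lines through a point. -/
noncomputable def pointFacet (p : P) : Finset (latticeA k ⧸ h.periods) :=
  (Set.toFinite ((fun l => h.vertexEquiv.symm (C.pointOn 0 l)) '' {l | C.Inc p l})).toFinset

theorem mem_lineFacet {l : L} {v : latticeA k ⧸ h.periods} :
    v ∈ h.lineFacet l ↔ C.Inc (h.vertexEquiv v) l := by
  simp [lineFacet]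

/-- A line is represented by its point of color `0`, so the lines `φ_a p` through `p` become the
points `φ_0 φ_a p`. -/
theorem mem_pointFacet {p : P} {v : latticeA k ⧸ h.periods} :
    v ∈ h.pointFacet p ↔ ∃ a, (Sum.inl (h.vertexEquiv v) : P ⊕ L) =
      C.coloring.phi 0 (C.coloring.phi a (.inl p)) := by
  simp only [pointFacet, Set.Finite.mem_toFinset, Set.mem_image, Set.mem_ofPred_eq,
    C.coloring.inc_iff_exists_phi]
  constructor
  · rintro ⟨l, ⟨a, ha⟩, rfl⟩
    exact ⟨a, by rw [Equiv.apply_symm_apply, ha, inl_pointOn]⟩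
  · rintro ⟨a, ha⟩
    obtain ⟨l, hl⟩ := C.coloring.exists_phi_inl a p
    refine ⟨l, ⟨a, hl⟩, h.vertexEquiv.symm_apply_eq.2 (Sum.inl_injective (β := L) ?_)⟩
    rw [ha, hl, inl_pointOn]

theorem card_lineFacet (l : L) : (h.lineFacet l).card = k + 1 := by
  rw [lineFacet, ← Set.ncard_eq_toFinset_card _ (Set.toFinite _),
    Set.ncard_image_of_injective _ h.vertexEquiv.symm.injective, C.ncard_points]

theorem card_pointFacet (p : P) : (h.pointFacet p).card = k + 1 := by
  rw [pointFacet, ← Set.ncard_eq_toFinset_card _ (Set.toFinite _)]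
  exact (Set.ncard_image_of_injective _
    (h.vertexEquiv.symm.injective.comp (C.pointOn_injective 0))).trans (C.ncard_lines p)

theorem lineFacet_mem_faces (l : L) : h.lineFacet l ∈ (quotientComplex h.periods).faces := by
  refine h.mem_faces_iff.2 ⟨Finset.card_pos.1 (by simp [h.card_lineFacet]), Or.inl ⟨l, ?_⟩⟩
  exact fun v => h.mem_lineFacet.1

theorem pointFacet_mem_faces (p : P) : h.pointFacet p ∈ (quotientComplex h.periods).faces := by
  refine h.mem_faces_iff.2 ⟨Finset.card_pos.1 (by simp [h.card_pointFacet]), Or.inr ⟨p, 0, ?_⟩⟩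
  exact fun v => h.mem_pointFacet.1

theorem isFacet_of_card {s : Finset (latticeA k ⧸ h.periods)}
    (hs : s ∈ (quotientComplex h.periods).faces) (hc : s.card = k + 1) :
    (quotientComplex h.periods).IsFacet s := by
  refine ⟨hs, fun t ht hst => ?_⟩
  exact (Finset.eq_of_subset_of_card_le hst
    ((card_le_of_mem_faces_quotientComplex ht).trans hc.ge)).ge

theorem isFacet_lineFacet (l : L) : (quotientComplex h.periods).IsFacet (h.lineFacet l) :=
  h.isFacet_of_card (h.lineFacet_mem_faces l) (h.card_lineFacet l)

theorem isFacet_pointFacet (p : P) : (quotientComplex h.periods).IsFacet (h.pointFacet p) :=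
  h.isFacet_of_card (h.pointFacet_mem_faces p) (h.card_pointFacet p)

theorem exists_facet_of_mem_faces {s : Finset (latticeA k ⧸ h.periods)}
    (hs : s ∈ (quotientComplex h.periods).faces) :
    (∃ l, s ⊆ h.lineFacet l) ∨ ∃ p, s ⊆ h.pointFacet p := by
  obtain ⟨-, ⟨l, hl⟩ | ⟨p, c, hp⟩⟩ := h.mem_faces_iff.1 hs
  · exact Or.inl ⟨l, fun v hv => h.mem_lineFacet.2 (hl v hv)⟩
  · obtain ⟨l, hl⟩ := C.coloring.exists_phi_inl 0 p
    -- The color `c` is traded for `0` at the price of moving the center: `φ_c φ_a p = φ_0 φ_a (φ_c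
    -- φ_0 p)`.
    refine Or.inr ⟨C.pointOn c l, fun v hv => h.mem_pointFacet.2 ?_⟩
    obtain ⟨a, ha⟩ := hp v hv
    exact ⟨a, by rw [ha, inl_pointOn, ← hl, C.sixCycle.phi_comm]⟩

theorem isFacet_iff {s : Finset (latticeA k ⧸ h.periods)} :
    (quotientComplex h.periods).IsFacet s ↔
      (∃ l, h.lineFacet l = s) ∨ ∃ p, h.pointFacet p = s := by
  refine ⟨fun hs => ?_, ?_⟩
  · refine (h.exists_facet_of_mem_faces hs.1).imp ?_ ?_
    · exact fun ⟨l, hl⟩ => ⟨l, subset_antisymm (hs.2 (h.lineFacet_mem_faces l) hl) hl⟩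
    · exact fun ⟨p, hp⟩ => ⟨p, subset_antisymm (hs.2 (h.pointFacet_mem_faces p) hp) hp⟩
  · rintro (⟨l, rfl⟩ | ⟨p, rfl⟩)
    exacts [h.isFacet_lineFacet l, h.isFacet_pointFacet p]

theorem hasDimension : (quotientComplex h.periods).HasDimension k := by
  obtain ⟨l, -⟩ := C.coloring.exists_phi_inl 0 (lab 0)
  refine ⟨⟨_, h.lineFacet_mem_faces l, h.card_lineFacet l⟩, ?_⟩
  rintro _ ⟨s, hs, rfl⟩
  exact card_le_of_mem_faces_quotientComplex hs

/-- The lattice `A_0` is trivial. This settles the case in which lines have one point and the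
two-point argument for injectivity of the facets is unavailable. -/
theorem subsingleton_points (hk : k = 0) : Subsingleton P := by
  subst hk
  refine ⟨fun p q => ?_⟩
  obtain ⟨x, rfl⟩ := h.surjective p
  obtain ⟨y, rfl⟩ := h.surjective q
  refine congrArg lab (Subtype.ext (funext fun i => ?_))
  have hx := latticeA_sum x
  have hy := latticeA_sum y
  rw [Fin.sum_univ_one] at hx hy
  rw [Fin.fin_one_eq_zero i, hx, hy]

theorem lineFacet_injective : Function.Injective h.lineFacet := by
  intro l l' hl
  have hinc : ∀ p, C.Inc p l → C.Inc p l' := fun p hp => by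
    have : h.vertexEquiv.symm p ∈ h.lineFacet l := h.mem_lineFacet.2 (by simpa)
    rw [hl, h.mem_lineFacet] at this
    simpa using this
  rcases Nat.eq_zero_or_pos k with hk | hk
  · have := h.subsingleton_points hk
    exact C.pointOn_injective 0 (Subsingleton.elim _ _)
  · obtain ⟨p, hp, q, hq, hpq⟩ := (Set.one_lt_ncard (Set.toFinite _)).1
      (by rw [C.ncard_points l]; omega : 1 < {p | C.Inc p l}.ncard)
    exact (C.eq_or_eq hp (hinc p hp) hq (hinc q hq)).resolve_left hpq

theorem pointFacet_injective : Function.Injective h.pointFacet := by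
  intro p p' hp
  have hinc : ∀ l, C.Inc p l → C.Inc p' l := fun l hl => by
    have : h.vertexEquiv.symm (C.pointOn 0 l) ∈ h.pointFacet p := by
      simpa [pointFacet, (C.pointOn_injective 0).eq_iff] using hl
    rw [hp] at this
    simpa [pointFacet, (C.pointOn_injective 0).eq_iff] using this
  rcases Nat.eq_zero_or_pos k with hk | hk
  · have := h.subsingleton_points hk
    exact Subsingleton.elim _ _
  · obtain ⟨l, hl, l', hl', hne⟩ := (Set.one_lt_ncard (Set.toFinite _)).1
      (by rw [C.ncard_lines p]; omega : 1 < {l | C.Inc p l}.ncard)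
    exact (C.eq_or_eq hl hl' (hinc l hl) (hinc l' hl')).resolve_right hne

theorem lineFacet_ne_pointFacet (hk : 2 ≤ k) (l : L) (p : P) :
    h.lineFacet l ≠ h.pointFacet p := by
  intro hlp
  have hinc : ∀ a q, (Sum.inl q : P ⊕ L) = C.coloring.phi 0 (C.coloring.phi a (.inl p)) →
      C.Inc q l := fun a q hq => by
    have : h.vertexEquiv.symm q ∈ h.pointFacet p := h.mem_pointFacet.2 ⟨a, by simpa using hq⟩
    rw [← hlp, h.mem_lineFacet] at this
    simpa using this
  have hpl : C.Inc p l := hinc 0 p (by rw [C.coloring.phi_phi])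
  obtain ⟨c, hc⟩ := C.coloring.inc_iff_exists_phi.1 hpl
  -- A third color exists because `k + 1 ≥ 3`. The line `m` of color `a` through `p` and `l` would
  -- share `p` and the point of color `0` on `m`: equal points force `a = 0`, equal lines force `a =
  -- c`.
  obtain ⟨a, ha⟩ : ∃ a : Fin (k + 1), a ∉ ({0, c} : Finset (Fin (k + 1))) := by
    by_contra! hall
    have := Finset.card_le_card (fun x _ => hall x : Finset.univ ⊆ ({0, c} : Finset (Fin (k + 1))))
    have h2 : ({0, c} : Finset (Fin (k + 1))).card ≤ 2 := Finset.card_le_two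
    simp at this
    omega
  simp only [Finset.mem_insert, Finset.mem_singleton, not_or] at ha
  obtain ⟨m, hm⟩ := C.coloring.exists_phi_inl a p
  have hq : (Sum.inl (C.pointOn 0 m) : P ⊕ L) = C.coloring.phi 0 (C.coloring.phi a (.inl p)) := by
    rw [hm, inl_pointOn]
  rcases C.eq_or_eq hpl (C.coloring.inc_iff_exists_phi.2 ⟨a, hm⟩) (hinc a _ hq)
    (C.coloring.inc_iff_exists_phi'.2 ⟨0, (C.inl_pointOn 0 m).symm⟩) with h1 | h1
  · rw [← h1, hm] at hq
    have h2 : C.coloring.phi 0 (.inl p) = .inr m := by rw [hq, C.coloring.phi_phi]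
    exact ha.1 (C.coloring.color_eq_of_phi_eq (hm.trans h2.symm))
  · rw [← h1, ← hc] at hm
    exact ha.2 (C.coloring.color_eq_of_phi_eq hm)

theorem exists_copies {n : ℕ} (hP : Nat.card P = n) (hL : Nat.card L = n) :
    ∃ (c : (quotientComplex h.periods).ConfigurationCopy C.toKConfiguration)
      (d : (quotientComplex h.periods).ConfigurationCopy C.toKConfiguration.dual),
      (∀ p, h.vertexEquiv (c.vertex p) = p) ∧
      {s | (quotientComplex h.periods).IsFacet s} = Set.range c.facet ∪ Set.range d.facet ∧
      (2 ≤ k → Disjoint (Set.range c.facet) (Set.range d.facet) ∧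
        {s | (quotientComplex h.periods).IsFacet s}.ncard = 2 * n) := by
  have hunion : {s | (quotientComplex h.periods).IsFacet s} =
      Set.range h.lineFacet ∪ Set.range h.pointFacet := Set.ext fun s => h.isFacet_iff
  refine ⟨⟨h.vertexEquiv.symm.toEmbedding, ⟨h.lineFacet, h.lineFacet_injective⟩,
      h.isFacet_lineFacet, fun l => Set.Finite.coe_toFinset _⟩,
    ⟨⟨fun l => h.vertexEquiv.symm (C.pointOn 0 l),
      h.vertexEquiv.symm.injective.comp (C.pointOn_injective 0)⟩,
      ⟨h.pointFacet, h.pointFacet_injective⟩, h.isFacet_pointFacet,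
      fun p => Set.Finite.coe_toFinset _⟩, fun p => h.vertexEquiv.apply_symm_apply p, hunion,
    fun hk => ?_⟩
  have hdisj : Disjoint (Set.range h.lineFacet) (Set.range h.pointFacet) := by
    rw [Set.disjoint_left]
    rintro _ ⟨l, rfl⟩ ⟨p, hp⟩
    exact h.lineFacet_ne_pointFacet hk l p hp.symm
  refine ⟨hdisj, ?_⟩
  rw [hunion, Set.ncard_union_eq hdisj (Set.finite_range _) (Set.finite_range _),
    ← Nat.card_coe_set_eq, ← Nat.card_coe_set_eq,
    Nat.card_range_of_injective h.lineFacet_injective,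
    Nat.card_range_of_injective h.pointFacet_injective, hP, hL, two_mul]

theorem exists_isFacet_superset {s : Finset (latticeA k ⧸ h.periods)}
    (hs : s ∈ (quotientComplex h.periods).faces) :
    ∃ t, (quotientComplex h.periods).IsFacet t ∧ s ⊆ t := by
  rcases h.exists_facet_of_mem_faces hs with ⟨l, hl⟩ | ⟨p, hp⟩
  exacts [⟨_, h.isFacet_lineFacet l, hl⟩, ⟨_, h.isFacet_pointFacet p, hp⟩]

theorem isTwoNeighborly (hC : C.toKConfiguration.IsProjectivePlane) :
    (quotientComplex h.periods).IsTwoNeighborly := by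
  classical
  intro s hs
  obtain ⟨v, w, hvw, rfl⟩ := Finset.card_eq_two.1 hs
  obtain ⟨l, ⟨h1, h2⟩, -⟩ := hC.existsUnique_line _ _ (h.vertexEquiv.injective.ne hvw)
  refine h.mem_faces_iff.2 ⟨by simp, Or.inl ⟨l, fun u hu => ?_⟩⟩
  simp only [Finset.mem_insert, Finset.mem_singleton] at hu
  rcases hu with rfl | rfl
  exacts [h1, h2]

/-! ### Automorphisms of the configuration acting on the complex -/

omit h in
theorem _root_.ColoredConfiguration.map_phi
    {ψ : Equiv.Perm P × Equiv.Perm L × Equiv.Perm (Fin (k + 1))}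
    (hψ : ψ ∈ C.Aut) (c : Fin (k + 1)) (v : P ⊕ L) :
    Sum.map ψ.1 ψ.2.1 (C.coloring.phi c v) =
      C.coloring.phi (ψ.2.2 c) (Sum.map ψ.1 ψ.2.1 v) := by
  obtain ⟨h1, h2⟩ := hψ
  rcases v with p | l
  · obtain ⟨l, hl⟩ := C.coloring.exists_phi_inl c p
    obtain ⟨hi, rfl⟩ := C.coloring.phi_inl_eq_inr_iff.1 hl
    rw [hl]
    exact (C.coloring.phi_inl_eq_inr_iff.2 ⟨(h1 p l).1 hi, h2 p l hi⟩).symm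
  · obtain ⟨p, hp⟩ := C.coloring.exists_phi_inr c l
    obtain ⟨hi, rfl⟩ := C.coloring.phi_inr_eq_inl_iff.1 hp
    rw [hp]
    exact (C.coloring.phi_inr_eq_inl_iff.2 ⟨(h1 p l).1 hi, h2 p l hi⟩).symm

/-- The permutation of the vertices induced by a permutation of the points. -/
noncomputable def vertexPermHom : Equiv.Perm P →* Equiv.Perm (latticeA k ⧸ h.periods) where
  toFun σ := h.vertexEquiv.symm.permCongr σ
  map_one' := by ext; simp
  map_mul' σ τ := by ext; simp

theorem vertexEquiv_vertexPermHom (σ : Equiv.Perm P) (v : latticeA k ⧸ h.periods) :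
    h.vertexEquiv (h.vertexPermHom σ v) = σ (h.vertexEquiv v) := by
  simp [vertexPermHom, Equiv.permCongr_apply]

/-- By `map_phi` an automorphism carries both kinds of faces to faces of the same kind, permuting
the colors that occur. -/
theorem map_mem_faces {ψ : Equiv.Perm P × Equiv.Perm L × Equiv.Perm (Fin (k + 1))}
    (hψ : ψ ∈ C.Aut) {s : Finset (latticeA k ⧸ h.periods)}
    (hs : s ∈ (quotientComplex h.periods).faces) :
    s.map (h.vertexPermHom ψ.1).toEmbedding ∈ (quotientComplex h.periods).faces := by
  rw [h.mem_faces_iff] at hs ⊢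
  refine ⟨hs.1.map, hs.2.imp ?_ ?_⟩
  · rintro ⟨l, hl⟩
    refine ⟨ψ.2.1 l, fun v hv => ?_⟩
    obtain ⟨w, hw, rfl⟩ := Finset.mem_map.1 hv
    rw [Equiv.coe_toEmbedding, h.vertexEquiv_vertexPermHom]
    exact (hψ.1 _ _).1 (hl w hw)
  · rintro ⟨p, c, hp⟩
    refine ⟨ψ.1 p, ψ.2.2 c, fun v hv => ?_⟩
    obtain ⟨w, hw, rfl⟩ := Finset.mem_map.1 hv
    obtain ⟨a, ha⟩ := hp w hw
    refine ⟨ψ.2.2 a, ?_⟩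
    have := congrArg (Sum.map ψ.1 ψ.2.1) ha
    rw [map_phi hψ, map_phi hψ] at this
    rw [Equiv.coe_toEmbedding, h.vertexEquiv_vertexPermHom]
    exact this

theorem vertexPermHom_mem_aut {ψ : Equiv.Perm P × Equiv.Perm L × Equiv.Perm (Fin (k + 1))}
    (hψ : ψ ∈ C.Aut) : h.vertexPermHom ψ.1 ∈ (quotientComplex h.periods).Aut := by
  refine fun s => ⟨h.map_mem_faces hψ, fun hs => ?_⟩
  have := h.map_mem_faces (C.Aut.inv_mem hψ) hs
  rw [Finset.map_map, Prod.fst_inv, map_inv] at this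
  convert this
  refine (Finset.map_refl (s := s)).symm.trans (congrArg (Finset.map · s) ?_)
  ext v
  simp

theorem exists_action {G : Type*} [Group G] (ρ : G →* C.Aut) :
    ∃ τ : G →* (quotientComplex h.periods).Aut, ∀ g v,
      h.vertexEquiv ((τ g : Equiv.Perm (latticeA k ⧸ h.periods)) v) =
        (ρ g).1.1 (h.vertexEquiv v) :=
  ⟨((h.vertexPermHom.comp (MonoidHom.fst _ _)).comp (C.Aut.subtype.comp ρ)).codRestrict _
    fun g => h.vertexPermHom_mem_aut (ρ g).2, fun _ _ => h.vertexEquiv_vertexPermHom _ _⟩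

end ColoredConfiguration.IsLabeling

/-! ### The geometric realization of a finite complex -/

namespace AbstractSimplicialComplex

open scoped unitInterval Topology

variable {V : Type*} (K : AbstractSimplicialComplex V)

namespace Realization

variable {K}

theorem continuous_apply (v : V) : Continuous fun x : K.Realization => x.1 v := by
  refine continuous_iSup_dom.2 fun s => continuous_coinduced_dom.2 ?_
  let _ : TopologicalSpace (K.closedSimplex s.1) :=
    TopologicalSpace.induced (K.coords s.1) inferInstance
  exact (_root_.continuous_apply v).comp continuous_induced_dom

/-- The realization of a finite complex carries the topology of the barycentric coordinates. -/
theorem isInducing_coords [Finite V] :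
    Topology.IsInducing fun (x : K.Realization) (v : V) => x.1 v := by
  refine ⟨le_antisymm (continuous_iff_le_induced.1 (continuous_pi continuous_apply)) ?_⟩
  rw [← continuous_id_iff_le]
  refine (@continuous_iff_isClosed _ _ (_) (_) _).2 fun Z hZ => ?_
  have hsimplex : ∀ s : {s : Finset V // s ∈ K.faces}, ∃ D : Set (V → ℝ), IsClosed D ∧
      Z ∩ K.closedSimplex s.1 = (fun (x : K.Realization) (v : V) => x.1 v) ⁻¹' D := fun s => by
    have h1 := isClosed_coinduced.1 (isClosed_iSup_iff.1 hZ s)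
    obtain ⟨D, hD, hDZ⟩ := isClosed_induced_iff.1 h1
    have hmem : ∀ x (hx : x ∈ K.closedSimplex s.1), (fun v => x.1 v) ∈ D ↔ x ∈ Z :=
      fun x hx => Set.ext_iff.1 hDZ ⟨x, hx⟩
    -- Requiring the coordinates outside `s` to vanish cuts out the closed simplex, so that `Z`
    -- becomes the preimage of a finite union of closed sets.
    refine ⟨D ∩ {f | ∀ v, v ∉ s.1 → f v = 0}, hD.inter ?_, ?_⟩
    · simp only [Set.ofPred_forall]
      exact isClosed_iInter fun v => isClosed_iInter fun _ =>
        isClosed_eq (_root_.continuous_apply v) continuous_const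
    · ext x
      have hx : x ∈ K.closedSimplex s.1 ↔ ∀ v, v ∉ s.1 → x.1 v = 0 := by
        refine forall_congr' fun v => ?_
        rw [Finsupp.mem_support_iff]
        exact not_imp_comm
      constructor
      · rintro ⟨h2, h3⟩
        exact ⟨(hmem x h3).2 h2, hx.1 h3⟩
      · rintro ⟨h2, h3⟩
        exact ⟨(hmem x (hx.2 h3)).1 h2, hx.2 h3⟩
  choose D hD hDZ using hsimplex
  have hZ' : Z = (fun (x : K.Realization) (v : V) => x.1 v) ⁻¹' ⋃ s, D s := by
    rw [Set.preimage_iUnion]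
    simp only [← hDZ]
    ext x
    simp only [Set.mem_iUnion, Set.mem_inter_iff, exists_and_left, iff_self_and]
    exact fun _ => ⟨⟨_, x.2.1⟩, Finset.Subset.refl _⟩
  exact isClosed_induced_iff.2 ⟨_, isClosed_iUnion_of_finite hD, hZ'.symm⟩

theorem continuous_iff [Finite V] {Y : Type*} [TopologicalSpace Y] {f : Y → K.Realization} :
    Continuous f ↔ ∀ v, Continuous fun y => (f y).1 v := by
  rw [isInducing_coords.continuous_iff, continuous_pi_iff]
  rfl

theorem ext {x y : K.Realization} (h : ∀ v, x.1 v = y.1 v) : x = y :=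
  Subtype.ext (Finsupp.ext h)

theorem support_nonempty (x : K.Realization) : x.1.support.Nonempty :=
  (K.isRelLowerSet_faces x.2.1).1

theorem sum_eq_one [Fintype V] (x : K.Realization) : ∑ v, x.1 v = 1 := by
  refine Eq.trans ?_ x.2.2.2
  exact (Finset.sum_subset (Finset.subset_univ _) fun v _ hv => by
    simpa using hv).symm

/-- A point given by its barycentric coordinates. -/
noncomputable def ofFun [Fintype V] (f : V → ℝ) (s : Finset V) (hs : s ∈ K.faces)
    (hf : ∀ v, f v ≠ 0 → v ∈ s) (h₀ : ∀ v, 0 ≤ f v) (h₁ : ∑ v, f v = 1) : K.Realization :=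
  ⟨Finsupp.equivFunOnFinite.symm f, by
    refine ⟨(K.isRelLowerSet_faces hs).2 (fun v hv => hf v (by simpa using hv)) ?_, h₀, ?_⟩
    · by_contra h
      rw [Finset.not_nonempty_iff_eq_empty, Finsupp.support_eq_empty] at h
      have : ∀ v, f v = 0 := fun v => DFunLike.congr_fun h v
      simp [this] at h₁
    · rw [← h₁]
      exact Finset.sum_subset (Finset.subset_univ _) fun v _ hv => by simpa using hv⟩

end Realization

/-- Two points of the realization lie in a common simplex. -/
def Joinable (x y : K.Realization) : Prop :=
  ∃ s ∈ K.faces, x.1.support ⊆ s ∧ y.1.support ⊆ s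

/-- Two vertices span a face. -/
def Adjacent (u w : V) : Prop := ∃ s ∈ K.faces, u ∈ s ∧ w ∈ s

/-- The closed star of a vertex. -/
def closedStar (v : V) : Set K.Realization := {x | ∃ s ∈ K.faces, v ∈ s ∧ x.1.support ⊆ s}

variable {K}

theorem mem_closedStar_of_ne_zero {x : K.Realization} {v : V} (h : x.1 v ≠ 0) :
    x ∈ K.closedStar v :=
  ⟨_, x.2.1, Finsupp.mem_support_iff.2 h, Finset.Subset.refl _⟩

theorem Adjacent.symm {u w : V} (h : K.Adjacent u w) : K.Adjacent w u :=
  let ⟨s, hs, hu, hw⟩ := h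
  ⟨s, hs, hw, hu⟩

theorem adjacent_self (v : V) : K.Adjacent v v := ⟨{v}, K.singleton_mem v, by simp, by simp⟩

/-! ### Straight paths, stars and edge paths -/

section Fintype

variable [Fintype V]

/-- The point `(1 - t) x + t y`. -/
noncomputable def lineMap {x y : K.Realization} (h : K.Joinable x y) (t : I) : K.Realization :=
  Realization.ofFun (fun v => (1 - (t : ℝ)) * x.1 v + t * y.1 v) h.choose h.choose_spec.1
    (fun v hv => by
      by_contra hvs
      have hx := Finsupp.notMem_support_iff.1 fun hx => hvs (h.choose_spec.2.1 hx)
      have hy := Finsupp.notMem_support_iff.1 fun hy => hvs (h.choose_spec.2.2 hy)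
      simp [hx, hy] at hv)
    (fun v => add_nonneg (mul_nonneg (sub_nonneg.2 t.2.2) (x.2.2.1 v))
      (mul_nonneg t.2.1 (y.2.2.1 v)))
    (by
      rw [Finset.sum_add_distrib, ← Finset.mul_sum, ← Finset.mul_sum, x.sum_eq_one, y.sum_eq_one]
      ring)

@[simp]
theorem lineMap_apply {x y : K.Realization} (h : K.Joinable x y) (t : I) (v : V) :
    (lineMap h t).1 v = (1 - (t : ℝ)) * x.1 v + t * y.1 v := rfl

theorem support_lineMap_subset {x y : K.Realization} (h : K.Joinable x y) (t : I) {s : Finset V}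
    (hx : x.1.support ⊆ s) (hy : y.1.support ⊆ s) : (lineMap h t).1.support ⊆ s := by
  intro v hv
  by_contra hvs
  have hx := Finsupp.notMem_support_iff.1 fun h => hvs (hx h)
  have hy := Finsupp.notMem_support_iff.1 fun h => hvs (hy h)
  simp [hx, hy] at hv

/-- The straight path between two points of a simplex. -/
noncomputable def segmentPath {x y : K.Realization} (h : K.Joinable x y) : Path x y where
  toFun := lineMap h
  continuous_toFun := Realization.continuous_iff.2 fun v => by
    simp only [lineMap_apply]
    fun_prop
  source' := Realization.ext fun v => by simp
  target' := Realization.ext fun v => by simp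

theorem segmentPath_apply {x y : K.Realization} (h : K.Joinable x y) (t : I) :
    segmentPath h t = lineMap h t := rfl

open Classical in
variable (K) in
/-- A vertex as a point of the realization. -/
noncomputable def vertexPoint (v : V) : K.Realization :=
  Realization.ofFun (Pi.single v 1) {v} (K.singleton_mem v)
    (fun w hw => by
      by_contra h
      rw [Finset.mem_singleton] at h
      exact hw (Pi.single_eq_of_ne h _))
    (fun w => by rw [Pi.single_apply]; split_ifs <;> simp) (by simp)

open Classical in
theorem vertexPoint_apply (v w : V) : (K.vertexPoint v).1 w = if w = v then 1 else 0 :=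
  Pi.single_apply v 1 w

theorem support_vertexPoint (v : V) : (K.vertexPoint v).1.support = {v} := by
  ext w
  simp [vertexPoint_apply]

theorem joinable_vertexPoint {x : K.Realization} {v : V} (h : x ∈ K.closedStar v) :
    K.Joinable x (K.vertexPoint v) := by
  obtain ⟨s, hs, hv, hx⟩ := h
  exact ⟨s, hs, hx, by simpa [support_vertexPoint] using hv⟩

theorem vertexPoint_mem_closedStar {u w : V} (h : K.Adjacent u w) :
    K.vertexPoint w ∈ K.closedStar u := by
  obtain ⟨s, hs, hu, hw⟩ := h
  exact ⟨s, hs, hu, by simpa [support_vertexPoint] using hw⟩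

theorem Adjacent.joinable {u w : V} (h : K.Adjacent u w) :
    K.Joinable (K.vertexPoint u) (K.vertexPoint w) :=
  joinable_vertexPoint (vertexPoint_mem_closedStar h.symm)

/-- Every point of the star shares a simplex with `v`, so the star contracts to `v` along straight
lines. -/
theorem contractibleSpace_closedStar (v : V) : ContractibleSpace (K.closedStar v) := by
  have hjoin : ∀ x : K.closedStar v, K.Joinable x.1 (K.vertexPoint v) :=
    fun x => joinable_vertexPoint x.2
  have hmem : ∀ (x : K.closedStar v) (t : I), lineMap (hjoin x) t ∈ K.closedStar v := by
    rintro ⟨x, s, hs, hv, hx⟩ t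
    exact ⟨s, hs, hv, support_lineMap_subset _ _ hx (by simpa [support_vertexPoint] using hv)⟩
  rw [contractible_iff_id_nullhomotopic]
  refine ⟨⟨K.vertexPoint v, vertexPoint_mem_closedStar (adjacent_self v)⟩, ⟨?_⟩⟩
  refine
    { toFun := fun p => ⟨lineMap (hjoin p.2) p.1, hmem p.2 p.1⟩
      continuous_toFun := ?_
      map_zero_left := fun x => Subtype.ext (segmentPath (hjoin x)).source
      map_one_left := fun x => Subtype.ext (segmentPath (hjoin x)).target }
  refine Continuous.subtype_mk (Realization.continuous_iff.2 fun w => ?_) _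
  simp only [lineMap_apply]
  have := (Realization.continuous_apply (K := K) w).comp
    (continuous_subtype_val.comp (continuous_snd (X := I) (Y := K.closedStar v)))
  simp only [Function.comp_def] at this
  fun_prop

/-- Stars are contractible, hence simply connected. This is the geometric source of the homotopies
below; the others only reparametrize or reassociate paths. -/
theorem homotopic_of_mem_closedStar {x y : K.Realization} {p q : Path x y} {v : V}
    (hp : ∀ t, p t ∈ K.closedStar v) (hq : ∀ t, q t ∈ K.closedStar v) : p.Homotopic q := by
  have := contractibleSpace_closedStar (K := K) v
  have hx : x ∈ K.closedStar v := by simpa using hp 0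
  have hy : y ∈ K.closedStar v := by simpa using hp 1
  let lift (r : Path x y) (hr : ∀ t, r t ∈ K.closedStar v) :
      Path (⟨x, hx⟩ : K.closedStar v) ⟨y, hy⟩ :=
    { toFun := fun t => ⟨r t, hr t⟩
      source' := by simp
      target' := by simp }
  exact (SimplyConnectedSpace.paths_homotopic (lift p hp) (lift q hq)).map
    ⟨Subtype.val, continuous_subtype_val⟩

theorem segmentPath_mem_closedStar {x y : K.Realization} (h : K.Joinable x y) {v : V}
    {s : Finset V} (hs : s ∈ K.faces) (hv : v ∈ s) (hx : x.1.support ⊆ s)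
    (hy : y.1.support ⊆ s) (t : I) : segmentPath h t ∈ K.closedStar v :=
  ⟨s, hs, hv, support_lineMap_subset h t hx hy⟩

theorem trans_mem {X : Type*} [TopologicalSpace X] {x y z : X} {p : Path x y} {q : Path y z}
    {S : Set X} (hp : ∀ t, p t ∈ S) (hq : ∀ t, q t ∈ S) (t : I) : p.trans q t ∈ S := by
  rw [Path.trans_apply]
  split_ifs
  exacts [hp _, hq _]

/-- The homotopy class of the straight path along an edge. -/
noncomputable def edgeClass {u w : V} (h : K.Adjacent u w) :
    Path.Homotopic.Quotient (K.vertexPoint u) (K.vertexPoint w) :=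
  .mk (segmentPath h.joinable)

theorem edgeClass_trans {u v w : V} {s : Finset V} (hs : s ∈ K.faces) (hu : u ∈ s) (hv : v ∈ s)
    (hw : w ∈ s) : (edgeClass (K := K) ⟨s, hs, hu, hv⟩).trans (edgeClass ⟨s, hs, hv, hw⟩) =
      edgeClass ⟨s, hs, hu, hw⟩ := by
  simp only [edgeClass]
  rw [← Path.Homotopic.Quotient.mk_trans,
    Path.Homotopic.Quotient.eq]
  refine homotopic_of_mem_closedStar (v := u) (trans_mem ?_ ?_) ?_ <;>
  refine segmentPath_mem_closedStar _ hs hu ?_ ?_ <;>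
  simpa [support_vertexPoint]

theorem edgeClass_self {u : V} (h : K.Adjacent u u) : edgeClass h = .refl (K.vertexPoint u) := by
  rw [edgeClass, ← Path.Homotopic.Quotient.mk_refl, Path.Homotopic.Quotient.eq]
  refine homotopic_of_mem_closedStar (v := u) ?_ fun t => vertexPoint_mem_closedStar h
  refine segmentPath_mem_closedStar _ (K.singleton_mem u) (by simp) ?_ ?_ <;>
  simp [support_vertexPoint]

theorem joinable_of_mem_support {x : K.Realization} {v : V} (h : x.1 v ≠ 0) :
    K.Joinable x (K.vertexPoint v) :=
  joinable_vertexPoint (mem_closedStar_of_ne_zero h)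

/-- Every homotopy class of paths between vertices is a product of edges. -/
theorem path_induction {v₀ : V}
    (Good : ∀ w, Path.Homotopic.Quotient (K.vertexPoint v₀) (K.vertexPoint w) → Prop)
    (hrefl : Good v₀ (.refl _))
    (hstep : ∀ u w (h : K.Adjacent u w) γ, Good u γ → Good w (γ.trans (edgeClass h)))
    (w : V) (γ : Path.Homotopic.Quotient (K.vertexPoint v₀) (K.vertexPoint w)) : Good w γ := by
  induction γ using Path.Homotopic.Quotient.ind with | mk p => ?_
  let q (t : I) : Path (K.vertexPoint v₀) (p t) := (p.subpath 0 t).cast p.source.symm rfl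
  have hq : ∀ t t', ((q t).trans (p.subpath t t')).Homotopic (q t') := fun t t' =>
    Path.Homotopic.pathCast ⟨Path.Homotopy.subpathTransSubpath p 0 t t'⟩ p.source.symm rfl
  -- `Q t` says that following `p` up to time `t` and then going straight to any vertex of the
  -- carrier of `p t` gives a good class.
  let Q (t : I) : Prop := ∀ (v : V) (hv : (p t).1 v ≠ 0),
    Good v (.mk ((q t).trans (segmentPath (joinable_of_mem_support hv))))
  have hloc : ∀ (v : V) (t t' : I), (∀ r ∈ Set.uIcc t t', (p r).1 v ≠ 0) → Q t → Q t' := by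
    intro v t t' hv hQ u hu
    have ht' := hv t' Set.right_mem_uIcc
    have hadj : K.Adjacent v u :=
      ⟨_, (p t').2.1, Finsupp.mem_support_iff.2 ht', Finsupp.mem_support_iff.2 hu⟩
    have h1 := hstep v u hadj _ (hQ v (hv t Set.left_mem_uIcc))
    convert h1 using 1
    rw [edgeClass, ← Path.Homotopic.Quotient.mk_trans, Path.Homotopic.Quotient.eq]
    refine ((hq t t').symm.hcomp (.refl _)).trans ?_
    refine .trans ⟨Path.Homotopy.transAssoc _ _ _⟩
      -- What remains compares the piece of `p` followed by the segment to `u` with the segment to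
      -- `v` followed by the edge `vu`. Both stay in the star of `v`, because the coordinate of `v`
      -- never vanishes on that piece.
      (.trans (.hcomp (.refl _) ?_) (.symm ⟨Path.Homotopy.transAssoc _ _ _⟩))
    refine homotopic_of_mem_closedStar (v := v) (trans_mem ?_ ?_) (trans_mem ?_ ?_)
    · intro r
      have : p.subpath t t' r ∈ Set.range (p.subpath t t') := ⟨r, rfl⟩
      rw [Path.range_subpath] at this
      obtain ⟨r', hr', hrr⟩ := this
      rw [← hrr]
      exact mem_closedStar_of_ne_zero (hv r' hr')
    · exact segmentPath_mem_closedStar _ (p t').2.1 (Finsupp.mem_support_iff.2 ht')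
        (Finset.Subset.refl _) (by simpa [support_vertexPoint] using hu)
    · have ht := Finsupp.mem_support_iff.2 (hv t Set.left_mem_uIcc)
      exact segmentPath_mem_closedStar _ (p t).2.1 ht (Finset.Subset.refl _)
        (by simpa [support_vertexPoint] using ht)
    · exact segmentPath_mem_closedStar _ (p t').2.1 (Finsupp.mem_support_iff.2 ht')
        (by simpa [support_vertexPoint] using ht') (by simpa [support_vertexPoint] using hu)
  have h01 : Q 0 → Q 1 := by
    -- Near each time `t` some coordinate stays nonzero on the whole interval between `t` and `r`,
    -- so `Q` passes both ways; connectedness of the unit interval does the rest.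
    refine PreconnectedSpace.induction₂' (fun t t' => Q t → Q t') (fun t => ?_)
      ⟨fun _ _ _ h₁ h₂ => h₂ ∘ h₁⟩ 0 1
    obtain ⟨v, hv⟩ := (p t).support_nonempty
    have hopen : {r | (p r).1 v ≠ 0} ∈ 𝓝 t :=
      (isOpen_ne.preimage ((Realization.continuous_apply v).comp p.continuous)).mem_nhds
        (Finsupp.mem_support_iff.1 hv)
    have htend : Filter.Tendsto (fun r => Set.uIcc t r) (𝓝 t) (𝓝 t).smallSets :=
      tendsto_const_nhds.uIcc Filter.tendsto_id
    filter_upwards [htend.eventually (Filter.eventually_smallSets_subset.2 hopen)] with r hr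
    exact ⟨hloc v t r hr, hloc v r t (Set.uIcc_comm t r ▸ hr)⟩
  have h0 : Q 0 := by
    intro v hv
    have hp0 : p 0 = K.vertexPoint v₀ := p.source
    have hvv : v = v₀ := by
      by_contra hne
      rw [hp0, vertexPoint_apply, if_neg hne] at hv
      exact hv rfl
    subst hvv
    convert hrefl using 1
    rw [← Path.Homotopic.Quotient.mk_refl, Path.Homotopic.Quotient.eq]
    refine homotopic_of_mem_closedStar (v := v) (trans_mem ?_ ?_)
      fun t => vertexPoint_mem_closedStar (adjacent_self v)
    · intro t
      simp only [q, Path.subpath_self, Path.cast_coe, Path.refl_apply]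
      exact mem_closedStar_of_ne_zero hv
    · exact segmentPath_mem_closedStar _ (p 0).2.1 (Finsupp.mem_support_iff.2 hv)
        (Finset.Subset.refl _) (by simp [support_vertexPoint])
  have hp1 : p 1 = K.vertexPoint w := p.target
  have hw : (p 1).1 w ≠ 0 := by simp [vertexPoint_apply]
  convert h01 h0 w hw using 1
  rw [Path.Homotopic.Quotient.eq]
  have h1 : (segmentPath (joinable_of_mem_support hw)).Homotopic
      ((Path.refl (K.vertexPoint w)).cast hp1 rfl) := by
    refine homotopic_of_mem_closedStar (v := w) ?_
      fun t => vertexPoint_mem_closedStar (adjacent_self w)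
    exact segmentPath_mem_closedStar _ (p 1).2.1 (Finsupp.mem_support_iff.2 hw)
      (Finset.Subset.refl _) (by simp [support_vertexPoint])
  refine .trans ?_ (Path.Homotopic.hcomp (.refl _) h1.symm)
  have h2 : (q 1).trans ((Path.refl (K.vertexPoint w)).cast hp1 rfl) = p.trans (.refl _) := by
    ext t
    simp [q, Path.trans_apply]
  rw [h2]
  exact .symm ⟨Path.Homotopy.transRefl p⟩

end Fintype

end AbstractSimplicialComplex

namespace AbstractSimplicialComplex

open scoped unitInterval Topology

variable {V : Type*} {K : AbstractSimplicialComplex V} [Fintype V]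

theorem joined_vertexPoint (x : K.Realization) : ∃ v, Joined x (K.vertexPoint v) :=
  let ⟨v, hv⟩ := x.support_nonempty
  ⟨v, ⟨segmentPath (joinable_of_mem_support (Finsupp.mem_support_iff.1 hv))⟩⟩

theorem sum_vertexPoint_mul (v : V) (g : V → ℝ) : ∑ w, (K.vertexPoint v).1 w * g w = g v := by
  classical
  simp [vertexPoint_apply]

/-! ### Winding numbers of integer cocycles -/

variable {δ : V → V → ℤ}

/-- The map to the circle whose coordinate on the star of a vertex `v` interpolates `δ v`. -/
noncomputable def circleMap (δ : V → V → ℤ) (x : K.Realization) : AddCircle (1 : ℝ) :=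
  ((∑ w, x.1 w * δ x.support_nonempty.choose w : ℝ) : AddCircle (1 : ℝ))

theorem _root_.AddCircle.coe_intCast (n : ℤ) : ((n : ℝ) : AddCircle (1 : ℝ)) = 0 :=
  AddCircle.coe_eq_zero_iff _ |>.2 ⟨n, by simp⟩

variable (hδ : ∀ s ∈ K.faces, ∀ u ∈ s, ∀ v ∈ s, ∀ w ∈ s, δ u v + δ v w = δ u w)

include hδ

/-- Changing the reference vertex within a simplex changes the interpolated value by the integer `δ
v u`, since barycentric coordinates sum to one; modulo 1 the choice is immaterial. -/
theorem circleMap_eq {x : K.Realization} {v : V} (hx : x ∈ K.closedStar v) :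
    circleMap δ x = ((∑ w, x.1 w * δ v w : ℝ) : AddCircle (1 : ℝ)) := by
  obtain ⟨s, hs, hv, hxs⟩ := hx
  set u := x.support_nonempty.choose
  have hu : u ∈ s := hxs x.support_nonempty.choose_spec
  have : ∑ w, x.1 w * δ v w = δ v u + ∑ w, x.1 w * δ u w := by
    have h1 : ∀ w, x.1 w * δ v w = x.1 w * δ v u + x.1 w * δ u w := fun w => by
      by_cases hw : x.1 w = 0
      · simp [hw]
      · rw [← hδ s hs v hv u hu w (hxs (Finsupp.mem_support_iff.2 hw))]
        push_cast
        ring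
    simp only [h1]
    rw [Finset.sum_add_distrib, ← Finset.sum_mul, x.sum_eq_one, one_mul]
  rw [this, AddCircle.coe_add, AddCircle.coe_intCast, zero_add]
  rfl

theorem continuous_circleMap : Continuous (circleMap δ : K.Realization → AddCircle (1 : ℝ)) := by
  refine continuous_iff_continuousAt.2 fun x => ?_
  obtain ⟨v, hv⟩ := x.support_nonempty
  have hcont : Continuous fun y : K.Realization =>
      ((∑ w, y.1 w * δ v w : ℝ) : AddCircle (1 : ℝ)) :=
    (AddCircle.continuous_mk' 1).comp (continuous_finsetSum _ fun w _ =>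
      (Realization.continuous_apply w).mul continuous_const)
  refine hcont.continuousAt.congr ?_
  have hopen : {y : K.Realization | y.1 v ≠ 0} ∈ 𝓝 x :=
    (isOpen_ne.preimage (Realization.continuous_apply v)).mem_nhds (Finsupp.mem_support_iff.1 hv)
  filter_upwards [hopen] with y hy
  exact (circleMap_eq hδ (mem_closedStar_of_ne_zero hy)).symm

theorem circleMap_vertexPoint (v : V) : circleMap δ (K.vertexPoint v) = 0 := by
  rw [circleMap_eq hδ (vertexPoint_mem_closedStar (adjacent_self v)),
    sum_vertexPoint_mul v fun w => (δ v w : ℝ)]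
  exact AddCircle.coe_intCast _

theorem circleMap_segmentPath {u w : V} (h : K.Adjacent u w) (t : I) :
    circleMap δ (segmentPath h.joinable t) = ((t * δ u w : ℝ) : AddCircle (1 : ℝ)) := by
  obtain ⟨s, hs, hu, hw⟩ := id h
  rw [circleMap_eq (v := u) hδ (segmentPath_mem_closedStar _ hs hu
    (by simpa [support_vertexPoint] using hu) (by simpa [support_vertexPoint] using hw) t)]
  have huu : δ u u = 0 := by simpa using hδ s hs u hu u hu u hu
  simp only [segmentPath_apply, lineMap_apply, add_mul, Finset.sum_add_distrib, mul_assoc,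
    ← Finset.mul_sum]
  rw [sum_vertexPoint_mul u fun w => (δ u w : ℝ), sum_vertexPoint_mul w fun w => (δ u w : ℝ), huu]
  simp

/-- A cocycle assigns winding numbers to the homotopy classes of paths between vertices. -/
theorem exists_winding (v₀ : V) :
    ∃ W : ∀ w, Path.Homotopic.Quotient (K.vertexPoint v₀) (K.vertexPoint w) → ℝ,
      W v₀ (.refl _) = 0 ∧
      ∀ u w (h : K.Adjacent u w) γ, W w (γ.trans (edgeClass h)) = W u γ + δ u w := by
  let cov := AddCircle.isCoveringMap_coe (1 : ℝ)
  let f : C(K.Realization, AddCircle (1 : ℝ)) := ⟨circleMap δ, continuous_circleMap hδ⟩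
  let e₀ : ((↑) : ℝ → AddCircle (1 : ℝ)) ⁻¹' {f (K.vertexPoint v₀)} :=
    ⟨0, (circleMap_vertexPoint hδ v₀).symm⟩
  -- The winding number is the endpoint of the lift to `ℝ`, starting at `0`, of the image path in
  -- the circle.
  refine ⟨fun w γ => (cov.monodromy (γ.map f) e₀).1, ?_, fun u w h γ => ?_⟩
  · have : (Path.Homotopic.Quotient.refl (K.vertexPoint v₀)).map f = .refl _ := rfl
    beta_reduce
    rw [this, cov.monodromy_refl]
    rfl
  · have hmap : (γ.trans (edgeClass h)).map f = (γ.map f).trans ((edgeClass h).map f) := by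
      induction γ using Path.Homotopic.Quotient.ind with | mk p => ?_
      exact congrArg Path.Homotopic.Quotient.mk (Path.map_trans _ _ _)
    beta_reduce
    rw [hmap, cov.monodromy_trans_apply]
    set e := cov.monodromy (γ.map f) e₀
    have he : ((e.1 : ℝ) : AddCircle (1 : ℝ)) = 0 :=
      e.2.trans (circleMap_vertexPoint hδ u)
    let Γ : Path e.1 (e.1 + δ u w) :=
      { toFun := fun t => e.1 + t * δ u w
        continuous_toFun := by fun_prop
        source' := by simp
        target' := by simp }
    have he' : ((e.1 + δ u w : ℝ) : AddCircle (1 : ℝ)) = f (K.vertexPoint w) := by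
      rw [AddCircle.coe_add, he, AddCircle.coe_intCast, zero_add]
      exact (circleMap_vertexPoint hδ w).symm
    have := cov.monodromy_eq_of_map_eq (γ := (edgeClass h).map f) (ex := e)
      (ey := ⟨_, he'⟩) (.mk Γ) ?_
    · rw [this]
    · refine congrArg Path.Homotopic.Quotient.mk ?_
      ext t
      change ((e.1 + t * δ u w : ℝ) : AddCircle (1 : ℝ)) =
        circleMap δ (segmentPath h.joinable t)
      rw [AddCircle.coe_add, he, zero_add, circleMap_segmentPath hδ h]

end AbstractSimplicialComplex

/-! ### The fundamental group of the quotient complex -/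

section FundamentalGroup

open AbstractSimplicialComplex

variable {k : ℕ} {H : AddSubgroup (latticeA k)}

theorem exists_lift_of_mem_faces {s : Finset (latticeA k ⧸ H)}
    (hs : s ∈ (quotientComplex H).faces) : ∃ F ∈ (complexW k).faces,
      ∀ v ∈ s, ∃ x ∈ F, (QuotientAddGroup.mk x : latticeA k ⧸ H) = v := by
  obtain ⟨F, hF, hsF⟩ := hs
  refine ⟨F, hF, fun v hv => ?_⟩
  have : v ∈ (s : Set (latticeA k ⧸ H)) := hv
  rw [hsF] at this
  exact this

theorem exists_rootVec_of_adjacent {u w : latticeA k ⧸ H} (h : (quotientComplex H).Adjacent u w) :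
    ∃ i j, w = u + QuotientAddGroup.mk (rootVec i j) := by
  obtain ⟨s, hs, hu, hw⟩ := h
  obtain ⟨F, hF, hlift⟩ := exists_lift_of_mem_faces hs
  obtain ⟨x, hx, rfl⟩ := hlift u hu
  obtain ⟨y, hy, rfl⟩ := hlift w hw
  obtain ⟨i, j, rfl⟩ := (mem_faces_complexW_iff.1 hF).2 x hx y hy
  exact ⟨i, j, rfl⟩

/-- The filled triangles here and in `exists_face_of_right` yield the two orders of the root
relation for the action on path classes. -/
theorem exists_face_of_left (v : latticeA k ⧸ H) (i j m : Fin (k + 1)) :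
    ∃ s ∈ (quotientComplex H).faces, v ∈ s ∧ v + QuotientAddGroup.mk (rootVec i j) ∈ s ∧
      v + QuotientAddGroup.mk (rootVec i m) ∈ s := by
  classical
  refine ⟨{v, v + QuotientAddGroup.mk (rootVec i j), v + QuotientAddGroup.mk (rootVec i m)},
    mem_faces_quotientComplex_iff.2 ⟨by simp, ?_⟩, by simp, by simp, by simp⟩
  induction v using QuotientAddGroup.induction_on with | H x => ?_
  refine ⟨x, i, Or.inl fun w hw => ?_⟩
  simp only [Finset.mem_insert, Finset.mem_singleton] at hw
  rcases hw with rfl | rfl | rfl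
  exacts [⟨i, by simp⟩, ⟨j, rfl⟩, ⟨m, rfl⟩]

theorem exists_face_of_right (v : latticeA k ⧸ H) (i j m : Fin (k + 1)) :
    ∃ s ∈ (quotientComplex H).faces, v ∈ s ∧ v + QuotientAddGroup.mk (rootVec j m) ∈ s ∧
      v + QuotientAddGroup.mk (rootVec i m) ∈ s := by
  classical
  refine ⟨{v, v + QuotientAddGroup.mk (rootVec j m), v + QuotientAddGroup.mk (rootVec i m)},
    mem_faces_quotientComplex_iff.2 ⟨by simp, ?_⟩, by simp, by simp, by simp⟩
  induction v using QuotientAddGroup.induction_on with | H x => ?_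
  refine ⟨x, m, Or.inr fun w hw => ?_⟩
  simp only [Finset.mem_insert, Finset.mem_singleton] at hw
  rcases hw with rfl | rfl | rfl
  exacts [⟨m, by simp⟩, ⟨j, rfl⟩, ⟨i, rfl⟩]

theorem adjacent_add_rootVec (v : latticeA k ⧸ H) (i j : Fin (k + 1)) :
    (quotientComplex H).Adjacent v (v + QuotientAddGroup.mk (rootVec i j)) :=
  let ⟨s, hs, hv, hw, _⟩ := exists_face_of_left v i j j
  ⟨s, hs, hv, hw⟩

open Classical in
/-- The root that leads from a vertex to an adjacent one (zero if the vertices are not adjacent). -/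
noncomputable def shortDiff (v w : latticeA k ⧸ H) : latticeA k :=
  if h : ∃ r : latticeA k, (∃ i j, r = rootVec i j) ∧ w = v + QuotientAddGroup.mk r then h.choose
  else 0

theorem SeparatesRoots.shortDiff_eq (hH : SeparatesRoots H) (v : latticeA k ⧸ H)
    (i j : Fin (k + 1)) : shortDiff v (v + QuotientAddGroup.mk (rootVec i j)) = rootVec i j := by
  have h : ∃ r : latticeA k, (∃ a b, r = rootVec a b) ∧
      v + QuotientAddGroup.mk (rootVec i j) = v + QuotientAddGroup.mk r := ⟨_, ⟨i, j, rfl⟩, rfl⟩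
  rw [shortDiff, dif_pos h]
  obtain ⟨⟨a, b, hab⟩, h2⟩ := h.choose_spec
  rw [hab] at h2 ⊢
  exact (hH _ _ _ _ (add_left_cancel h2)).symm

/-- On a face lifted to `W_k`, the chosen roots are the differences of the lifts. Each coordinate of
`shortDiff` is therefore an integer cocycle. -/
theorem SeparatesRoots.shortDiff_add (hH : SeparatesRoots H) {s : Finset (latticeA k ⧸ H)}
    (hs : s ∈ (quotientComplex H).faces) {u v w : latticeA k ⧸ H} (hu : u ∈ s) (hv : v ∈ s)
    (hw : w ∈ s) : shortDiff u v + shortDiff v w = shortDiff u w := by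
  obtain ⟨F, hF, hlift⟩ := exists_lift_of_mem_faces hs
  obtain ⟨x, hx, rfl⟩ := hlift u hu
  obtain ⟨y, hy, rfl⟩ := hlift v hv
  obtain ⟨z, hz, rfl⟩ := hlift w hw
  have key : ∀ x ∈ F, ∀ y ∈ F,
      shortDiff (QuotientAddGroup.mk x : latticeA k ⧸ H) (QuotientAddGroup.mk y) = y - x := by
    intro x hx y hy
    obtain ⟨i, j, rfl⟩ := (mem_faces_complexW_iff.1 hF).2 x hx y hy
    rw [QuotientAddGroup.mk_add, hH.shortDiff_eq]
    abel
  rw [key x hx y hy, key y hy z hz, key x hx z hz]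
  abel

theorem add_mk_rootVec (v : latticeA k ⧸ H) (i j m : Fin (k + 1)) :
    v + QuotientAddGroup.mk (rootVec i j) + QuotientAddGroup.mk (rootVec j m) =
      v + QuotientAddGroup.mk (rootVec i m) := by
  rw [add_assoc, ← QuotientAddGroup.mk_add, rootVec_add]

/-! ### The lattice action on the vertices of the universal cover -/

variable [Fintype (latticeA k ⧸ H)]

variable (H) in
/-- The vertices of the universal cover: homotopy classes of paths from the base vertex. -/
abbrev CoverVertex : Type :=
  Σ w : latticeA k ⧸ H, Path.Homotopic.Quotient ((quotientComplex H).vertexPoint 0)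
    ((quotientComplex H).vertexPoint w)

namespace CoverVertex

variable (H) in
/-- The class of the constant path. -/
noncomputable def base : CoverVertex H := ⟨0, .refl _⟩

/-- The neighbor along the lift of an edge. -/
noncomputable def step (p : CoverVertex H) {w : latticeA k ⧸ H}
    (h : (quotientComplex H).Adjacent p.1 w) : CoverVertex H := ⟨w, p.2.trans (edgeClass h)⟩

theorem step_congr (p : CoverVertex H) {w w' : latticeA k ⧸ H}
    (h : (quotientComplex H).Adjacent p.1 w) (h' : (quotientComplex H).Adjacent p.1 w')
    (hw : w = w') : p.step h = p.step h' := by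
  subst hw
  rfl

theorem step_self (p : CoverVertex H) {w : latticeA k ⧸ H}
    (h : (quotientComplex H).Adjacent p.1 w) (hw : p.1 = w) : p.step h = p := by
  subst hw
  rw [step, edgeClass_self, Path.Homotopic.Quotient.trans_refl]

theorem step_step (p : CoverVertex H) {v w : latticeA k ⧸ H} {s : Finset (latticeA k ⧸ H)}
    (hs : s ∈ (quotientComplex H).faces) (hp : p.1 ∈ s) (hv : v ∈ s) (hw : w ∈ s)
    (h : (quotientComplex H).Adjacent p.1 v) (h' : (quotientComplex H).Adjacent v w)
    (h'' : (quotientComplex H).Adjacent p.1 w) :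
    (p.step h).step (w := w) h' = p.step h'' := by
  simp only [step]
  rw [Path.Homotopic.Quotient.trans_assoc]
  exact congrArg (fun γ => (⟨w, p.2.trans γ⟩ : CoverVertex H)) (edgeClass_trans hs hp hv hw)

/-- The step along a root. -/
noncomputable def shift (i j : Fin (k + 1)) (p : CoverVertex H) : CoverVertex H :=
  p.step (adjacent_add_rootVec p.1 i j)

theorem shift_shift_left (i j m : Fin (k + 1)) (p : CoverVertex H) :
    shift j m (shift i j p) = shift i m p := by
  obtain ⟨s, hs, h1, h2, h3⟩ := exists_face_of_left p.1 i j m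
  have hw := add_mk_rootVec p.1 i j m
  exact (step_step p hs h1 h2 (hw ▸ h3) _ _ ⟨s, hs, h1, hw ▸ h3⟩).trans (step_congr p _ _ hw)

theorem shift_shift_right (i j m : Fin (k + 1)) (p : CoverVertex H) :
    shift i j (shift j m p) = shift i m p := by
  obtain ⟨s, hs, h1, h2, h3⟩ := exists_face_of_right p.1 i j m
  have hw : p.1 + QuotientAddGroup.mk (rootVec j m) + QuotientAddGroup.mk (rootVec i j) =
      p.1 + QuotientAddGroup.mk (rootVec i m) := by
    rw [add_right_comm, add_mk_rootVec]
  exact (step_step p hs h1 h2 (hw ▸ h3) _ _ ⟨s, hs, h1, hw ▸ h3⟩).trans (step_congr p _ _ hw)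

theorem shift_self (i : Fin (k + 1)) (p : CoverVertex H) : shift i i p = p :=
  step_self p _ (by simp)

variable (H) in
theorem exists_action : ∃ D : Multiplicative (latticeA k) →* Equiv.Perm (CoverVertex H),
    ∀ u i j p, D (.ofAdd (u + rootVec i j)) p = shift i j (D (.ofAdd u) p) := by
  obtain ⟨D, hD⟩ := exists_latticeHom (G := Equiv.Perm (CoverVertex H))
    (fun i j => ⟨shift i j, shift j i, fun p => by rw [shift_shift_left, shift_self],
      fun p => by rw [shift_shift_left, shift_self]⟩)
    (fun i j m => Equiv.ext fun p => shift_shift_right i j m p)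
    (fun i j m => Equiv.ext fun p => shift_shift_left i j m p)
  refine ⟨D, fun u i j p => ?_⟩
  rw [add_comm u, ofAdd_add, map_mul, hD]
  rfl

variable {D : Multiplicative (latticeA k) →* Equiv.Perm (CoverVertex H)}
  (hD : ∀ u i j p, D (.ofAdd (u + rootVec i j)) p = shift i j (D (.ofAdd u) p))

include hD

theorem action_fst (a : latticeA k) (p : CoverVertex H) :
    (D (.ofAdd a) p).1 = p.1 + QuotientAddGroup.mk a := by
  refine root_induction (v₀ := 0) (p := fun a => (D (.ofAdd a) p).1 = p.1 + QuotientAddGroup.mk a)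
    (by simp) (fun u i j _ hu => ?_) a
  rw [hD, QuotientAddGroup.mk_add, ← add_assoc, ← hu]
  rfl

/-- The action only appends edges at the end, so it commutes with prefixing a loop. -/
theorem action_trans (a : latticeA k) (g : Path.Homotopic.Quotient
    ((quotientComplex H).vertexPoint 0) ((quotientComplex H).vertexPoint 0)) (p : CoverVertex H) :
    D (.ofAdd a) ⟨p.1, g.trans p.2⟩ =
      ⟨(D (.ofAdd a) p).1, g.trans (D (.ofAdd a) p).2⟩ := by
  refine root_induction (v₀ := 0) (p := fun a => D (.ofAdd a) ⟨p.1, g.trans p.2⟩ =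
    ⟨(D (.ofAdd a) p).1, g.trans (D (.ofAdd a) p).2⟩) ?_ (fun u i j _ hu => ?_) a
  · rw [ofAdd_zero, map_one]
    rfl
  rw [hD, hD, hu]
  simp only [shift, step, Path.Homotopic.Quotient.trans_assoc]

theorem action_transitive (p : CoverVertex H) : ∃ a : latticeA k, D (.ofAdd a) (base H) = p := by
  obtain ⟨w, γ⟩ := p
  refine path_induction (K := quotientComplex H) (v₀ := 0)
    (fun w γ => ∃ a : latticeA k, D (.ofAdd a) (base H) = ⟨w, γ⟩) ⟨0, by simp [base]⟩ ?_ w γ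
  rintro u w h γ ⟨a, ha⟩
  obtain ⟨i, j, rfl⟩ := exists_rootVec_of_adjacent h
  exact ⟨a + rootVec i j, by rw [hD, ha]; rfl⟩

/-- The winding number of coordinate `m` along the class reached by `a` is `a.1 m`, by induction
along roots; for the constant class it is zero. -/
theorem action_free (hH : SeparatesRoots H) {a : latticeA k}
    (ha : D (.ofAdd a) (base H) = base H) : a = 0 := by
  refine Subtype.ext (funext fun m => ?_)
  obtain ⟨W, hW0, hW⟩ := exists_winding (K := quotientComplex H)
    (δ := fun v w => (shortDiff v w).1 m)
    (fun s hs u hu v hv w hw =>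
      congrArg (fun x : latticeA k => x.1 m) (hH.shortDiff_add hs hu hv hw)) 0
  have key : ∀ a : latticeA k,
      W (D (.ofAdd a) (base H)).1 (D (.ofAdd a) (base H)).2 = a.1 m := by
    refine root_induction (v₀ := 0) ?_ fun u i j _ hu => ?_
    · rw [ofAdd_zero, map_one]
      exact hW0.trans Int.cast_zero.symm
    · rw [hD]
      refine (hW _ _ _ _).trans ?_
      rw [hu]
      refine Eq.trans ?_ (Int.cast_add (u.1 m) ((rootVec i j : latticeA k).1 m)).symm
      exact congrArg (fun r : latticeA k => (u.1 m : ℝ) + (r.1 m : ℤ)) (hH.shortDiff_eq _ i j)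
  have := key a
  rw [ha] at this
  exact_mod_cast this.symm.trans hW0

end CoverVertex

open CoverVertex

variable (H) in
theorem pathConnectedSpace_quotientComplex :
    PathConnectedSpace (quotientComplex H).Realization := by
  obtain ⟨D, hD⟩ := CoverVertex.exists_action H
  -- The class reached from the base by `a` contains a path to the vertex of `a`.
  have key : ∀ x, Joined ((quotientComplex H).vertexPoint 0) x := fun x => by
    obtain ⟨v, hv⟩ := joined_vertexPoint x
    refine Joined.trans ?_ hv.symm
    obtain ⟨a, rfl⟩ := QuotientAddGroup.mk_surjective v
    have hfst := action_fst hD a (base H)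
    rw [base, zero_add] at hfst
    rw [← hfst]
    obtain ⟨p, -⟩ := Path.Homotopic.Quotient.mk_surjective (D (.ofAdd a) (base H)).2
    exact ⟨p⟩
  exact ⟨⟨(quotientComplex H).vertexPoint 0⟩, fun x y => (key x).symm.trans (key y)⟩

/-- The action is free and transitive on path classes and moves the endpoint by `a` modulo `H`, so
the elements of `H` correspond exactly to the loop classes. -/
theorem SeparatesRoots.nonempty_fundamentalGroup_mulEquiv (hH : SeparatesRoots H) :
    Nonempty (Multiplicative H ≃* FundamentalGroup (quotientComplex H).Realization
      ((quotientComplex H).vertexPoint 0)) := by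
  obtain ⟨D, hD⟩ := CoverVertex.exists_action H
  have hloop : ∀ a : H, ∃ g, D (.ofAdd a.1) (base H) = ⟨0, g⟩ := fun a => by
    have hfst : (D (.ofAdd a.1) (base H)).1 = 0 := by
      rw [action_fst hD, (QuotientAddGroup.eq_zero_iff _).2 a.2]
      simp [base]
    generalize D (.ofAdd a.1) (base H) = p at hfst
    obtain ⟨w, g⟩ := p
    subst hfst
    exact ⟨g, rfl⟩
  choose θ hθ using hloop
  have hinj : ∀ {g g' : Path.Homotopic.Quotient ((quotientComplex H).vertexPoint 0)
      ((quotientComplex H).vertexPoint 0)}, (⟨0, g⟩ : CoverVertex H) = ⟨0, g'⟩ → g = g' :=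
    fun h => eq_of_heq (Sigma.mk.inj h).2
  have hadd : ∀ a b, θ (a + b) = (θ b).trans (θ a) := fun a b => by
    apply hinj
    rw [← hθ, AddSubgroup.coe_add, ofAdd_add, map_mul, Equiv.Perm.mul_apply, hθ b]
    -- Reading `θ b` as `θ b` followed by the constant loop, the action of `a` turns the latter into
    -- `θ a`.
    have := action_trans hD a.1 (θ b) (base H)
    rw [hθ a] at this
    simpa [base, Path.Homotopic.Quotient.trans_refl] using this
  let Θ : Multiplicative H →* FundamentalGroup (quotientComplex H).Realization
      ((quotientComplex H).vertexPoint 0) :=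
    MonoidHom.mk' (fun a => θ a.toAdd) fun a b => hadd a.toAdd b.toAdd
  refine ⟨MulEquiv.ofBijective Θ ⟨(injective_iff_map_eq_one Θ).2 fun a ha => ?_, fun g => ?_⟩⟩
  · have h1 : θ a.toAdd = .refl _ := ha
    have h2 := hθ a.toAdd
    rw [h1] at h2
    exact Multiplicative.toAdd.injective (Subtype.ext (action_free hD hH h2))
  · obtain ⟨a, ha⟩ := action_transitive hD (⟨0, g⟩ : CoverVertex H)
    have haH : a ∈ H := by
      rw [← QuotientAddGroup.eq_zero_iff]
      have := action_fst hD a (base H)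
      rw [ha] at this
      simpa [base] using this.symm
    exact ⟨.ofAdd ⟨a, haH⟩, hinj ((hθ ⟨a, haH⟩).symm.trans ha)⟩

end FundamentalGroup

/-! ### The rank of a sublattice of finite index -/

section Rank

variable {k : ℕ}

variable (k) in
/-- Dropping the first coordinate identifies `A_k` with `ℤ^k`. -/
def latticeEquiv : latticeA k ≃ₗ[ℤ] (Fin k → ℤ) where
  toFun x i := x.1 i.succ
  map_add' _ _ := rfl
  map_smul' _ _ := rfl
  invFun y := ⟨Fin.cons (-∑ i, y i) y, by
    change ∑ i, (Fin.cons (-∑ i, y i) y : Fin (k + 1) → ℤ) i = 0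
    rw [Fin.sum_univ_succ]
    simp⟩
  left_inv x := by
    have := latticeA_sum x
    rw [Fin.sum_univ_succ] at this
    refine Subtype.ext (funext (Fin.cases ?_ fun i => rfl))
    change -∑ i : Fin k, x.1 i.succ = x.1 0
    omega
  right_inv y := funext fun i => rfl

theorem nonempty_addEquiv_of_finite_quotient (H : AddSubgroup (latticeA k))
    [Finite (latticeA k ⧸ H)] : Nonempty (H ≃+ (Fin k → ℤ)) := by
  have := Module.Free.of_equiv (latticeEquiv k).symm
  have := Module.Finite.equiv (latticeEquiv k).symm
  let N := H.toIntSubmodule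
  have hcard : Nat.card (latticeA k ⧸ H) ≠ 0 := Nat.card_pos.ne'
  have hmem : ∀ x : latticeA k, (Nat.card (latticeA k ⧸ H) : ℤ) • x ∈ N := fun x => by
    change _ ∈ H
    rw [← QuotientAddGroup.eq_zero_iff, QuotientAddGroup.mk_zsmul, natCast_zsmul]
    exact card_nsmul_eq_zero'
  -- Multiplication by the index embeds the whole lattice into `H`, so the rank does not drop.
  have hle : Module.finrank ℤ (latticeA k) ≤ Module.finrank ℤ N := by
    refine LinearMap.finrank_le_finrank_of_injective
      (f := ((LinearMap.lsmul ℤ (latticeA k)) (Nat.card (latticeA k ⧸ H))).codRestrict N hmem) ?_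
    intro x y hxy
    have := congrArg Subtype.val hxy
    exact smul_right_injective _ (by exact_mod_cast hcard) this
  have hrank : Module.finrank ℤ N = Module.finrank ℤ (Fin k → ℤ) := by
    rw [← (latticeEquiv k).finrank_eq]
    exact le_antisymm (Submodule.finrank_le N) hle
  exact ⟨(LinearEquiv.ofFinrankEq N (Fin k → ℤ) hrank).toAddEquiv⟩

end Rank

theorem mainTheorem1 {k n : ℕ} {P : Type*} {L : Type*} [Finite P] [Finite L]
    (C : ColoredConfiguration (k + 1) P L) (hP : Nat.card P = n) (hL : Nat.card L = n) :
    -- the labeling rule has exactly one solution for each initial value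
    (∀ (v₀ : latticeA k) (p₀ : P), ∃! lab : latticeA k → P, C.IsLabeling lab ∧ lab v₀ = p₀) ∧
    ∀ lab : latticeA k → P, C.IsLabeling lab →
      ∃ H : AddSubgroup (latticeA k), (∀ v, v ∈ H ↔ lab v = lab 0) ∧
      IsSimplicialQuotient H ∧
      PathConnectedSpace (quotientComplex H).Realization ∧
      (quotientComplex H).HasDimension k ∧
      (∀ x : (quotientComplex H).Realization,
        Nonempty (FundamentalGroup (quotientComplex H).Realization x ≃*
          Multiplicative (Fin k → ℤ))) ∧
      -- exactly `n` vertices, identified with the points of `C` by the labeling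
      Nat.card (latticeA k ⧸ H) = n ∧
      ∃ e : latticeA k ⧸ H ≃ P, (∀ v : latticeA k, e (QuotientAddGroup.mk v) = lab v) ∧
      -- the facets form a copy of `C` and a copy of its dual
      (∃ (c : (quotientComplex H).ConfigurationCopy C.toKConfiguration)
          (d : (quotientComplex H).ConfigurationCopy C.toKConfiguration.dual),
        (∀ p, e (c.vertex p) = p) ∧
        {s | (quotientComplex H).IsFacet s} = Set.range c.facet ∪ Set.range d.facet ∧
        (2 ≤ k → Disjoint (Set.range c.facet) (Set.range d.facet) ∧
          {s | (quotientComplex H).IsFacet s}.ncard = 2 * n)) ∧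
      (∀ s ∈ (quotientComplex H).faces, ∃ t, (quotientComplex H).IsFacet t ∧ s ⊆ t) ∧
      -- group actions
      (∀ (G : Type*) [Group G] (ρ : G →* C.Aut),
        ∃ τ : G →* (quotientComplex H).Aut,
          ∀ g v, e ((τ g : Equiv.Perm (latticeA k ⧸ H)) v) = (ρ g).1.1 (e v)) ∧
      (C.toKConfiguration.IsProjectivePlane → (quotientComplex H).IsTwoNeighborly) := by
  refine ⟨fun v₀ p₀ => ?_, fun lab h => ?_⟩
  · obtain ⟨lab, h, h₀⟩ := C.exists_isLabeling v₀ p₀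
    exact ⟨lab, ⟨h, h₀⟩, fun lab' h' =>
      ColoredConfiguration.eq_of_isLabeling h'.1 h (h'.2.trans h₀.symm)⟩
  · have hfin := h.finite_vertices
    let _ := Fintype.ofFinite (latticeA k ⧸ h.periods)
    have hpath := pathConnectedSpace_quotientComplex h.periods
    refine ⟨h.periods, fun v => Iff.rfl, h.separatesRoots.isSimplicialQuotient, hpath,
      h.hasDimension, fun x => ?_, (Nat.card_congr h.vertexEquiv).trans hP, h.vertexEquiv,
      h.vertexEquiv_mk, h.exists_copies hP hL, fun s hs => h.exists_isFacet_superset hs,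
      fun G _ ρ => h.exists_action ρ, h.isTwoNeighborly⟩
    obtain ⟨Θ⟩ := h.separatesRoots.nonempty_fundamentalGroup_mulEquiv
    obtain ⟨E⟩ := nonempty_addEquiv_of_finite_quotient h.periods
    exact ⟨((FundamentalGroup.fundamentalGroupMulEquivOfPathConnected x _).trans Θ.symm).trans
      (AddEquiv.toMultiplicative E)⟩
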